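/- Let $X$ be an isotropic $L$-space: a commutative monoid $(X,+,\theta)$ with a multiplication by real numbers satisfying $\alpha(x+y)=\alpha x+\alpha y$, $\alpha(\beta x)=(\alpha\beta)x$, $1\cdot x=x$, $0\cdot x=\theta$, and with a complete separable metric $h_X$ such that $h_X(\alpha x,\alpha y)=|\alpha|h_X(x,y)$ and $h_X(x+z,y+z)=h_X(x,y)$. Put $\|x\|_X=h_X(x,\theta)$. Let $X^{\rm c}$ be the set of convex elements, i.e. of $x\in X$ with $(\alpha+\beta)x=\alpha x+\beta x$ for all $\alpha,\beta\ge 0$. Let $P$ be a convexifying operator of $X$, that is, a map of $X$ onto $X^{\rm c}$ with $P\circ P=P$, $h_X(P(x),P(y))\le h_X(x,y)$ and $P(\alpha x+\beta y)=\alpha P(x)+\beta P(y)$ for all $x,y\in X$ and $\alpha,\beta\in\mathbb R$. The integral of a simple function on $[a,b]$ with values $f_i$ on disjoint measurable sets $T_i$ is $\sum_i\mu(T_i)P(f_i)$ ($\mu$ is the Lebesgue measure), and the integral of a continuous $X$-valued function is the limit of the integrals of simple functions that converge to it uniformly. Let $\omega\colon[0,\infty)\to\mathbb R$ be a modulus of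 continuity (continuous, non-decreasing, semi-additive, $\omega(0)=0$) that is not identically zero. Let $H^\omega([a,b],X)$ be the class of $\phi\colon[a,b]\to X$ with $h_X(\phi(s),\phi(u))\le\omega(|s-u|)$ for all $s,u\in[a,b]$, let $W^1H^\omega([a,b],X)$ be the class of functions $f(u)=x+\int_a^u\phi(s)\,ds$ with $x\in X^{\rm c}$ and $\phi\in H^\omega([a,b],X)$, and let $\overline W^1H^\omega([a,b],X)=\bigcup_{k>0}k\cdot W^1H^\omega([a,b],X)$. For a function $g\colon[a,b]\to X$ set $\|g\|_{\omega,X}=\sup_{s\ne u}h_X(g(s),g(u))/\omega(|s-u|)$. Write $z=x-_Hy$ if $x=y+z$ (such $z$ is unique if it exists), and let $$\mathcal D_Hf(u)=\lim_{\gamma\to+0}\gamma^{-1}(f(u+\gamma)-_Hf(u))=\lim_{\gamma\to+0}\gamma^{-1}(f(u)-_Hf(u-\gamma))$$ (only the limit that makes sense at $u=a$ and at $u=b$), where the differences are required to exist for all small $\gamma>0$. Set $$\Delta^H_{\gamma_1,\gamma_2}f(t)=\frac{f(t+\gamma_2)-_Hf(t-\gamma_1)}{\gamma_1+\gamma_2},\qquad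 I(\alpha)=\int_0^\alpha\omega(s)\,ds,$$ $$K(\gamma_1,\gamma_2;h_1,h_2)=\frac{(h_1-\gamma_1)+(h_2-\gamma_2)}{(h_1+h_2)^2}\left\{I\left(\frac{(h_1+h_2)(h_1-\gamma_1)}{(h_1-\gamma_1)+(h_2-\gamma_2)}\right)+I\left(\frac{(h_1+h_2)(h_2-\gamma_2)}{(h_1-\gamma_1)+(h_2-\gamma_2)}\right)\right\},$$ with $K=0$ if $\gamma_1=h_1$ and $\gamma_2=h_2$. Let $h_1,h_2\ge0$, $h_1+h_2>0$, $[t-h_1,t+h_2]\subset[a,b]$. Then for every $f\in\overline W^1H^\omega([a,b],X)$ the derivative $\mathcal D_Hf$ exists on $[a,b]$, $\|\mathcal D_Hf\|_{\omega,X}<\infty$, the difference $f(v)-_Hf(u)$ exists whenever $a\le u\le v\le b$, and (1) for all $\gamma_1,\gamma_2\ge0$ with $\gamma_1+\gamma_2>0$ and $[t-\gamma_1,t+\gamma_2]\subset[t-h_1,t+h_2]$, $$\|\Delta^H_{\gamma_1,\gamma_2}f(t)\|_X\le K(\gamma_1,\gamma_2;h_1,h_2)\,\|\mathcal D_Hf\|_{\omega,X}+\|\Delta^H_{h_1,h_2}f(t)\|_X;$$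 (2) $$\|\mathcal D_Hf(t)\|_X\le\frac{I(h_1)+I(h_2)}{h_1+h_2}\,\|\mathcal D_Hf\|_{\omega,X}+\|\Delta^H_{h_1,h_2}f(t)\|_X.$$ Assume moreover that $X^{\rm c}\ne\{\theta\}$. If $\omega$ is concave, then (1) is sharp: for all $\gamma_1,\gamma_2$ as in (1) there is an $f\in W^1H^\omega([a,b],X)$ with $\|\mathcal D_Hf\|_{\omega,X}=1$ for which (1) is an equality. For an arbitrary $\omega$, (2) is sharp: there is an $f\in W^1H^\omega([a,b],X)$ with $\|\mathcal D_Hf\|_{\omega,X}=1$ for which (2) is an equality. -/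

import Mathlib

open Set Filter Topology MeasureTheory

/-- An `L`-space: a semilinear space (the commutative monoid and distributive action laws, together
with `0 • x = 0`) with a complete separable metric that is homogeneous with respect to scalars and
satisfies `h (x + z) (y + z) ≤ h x y`. -/
class LSpace (X : Type*) [MetricSpace X] [AddCommMonoid X] [DistribMulAction ℝ X] : Prop
    extends CompleteSpace X, TopologicalSpace.SeparableSpace X where
  zero_smul_eq : ∀ x : X, (0 : ℝ) • x = 0
  dist_smul_smul : ∀ (α : ℝ) (x y : X), dist (α • x) (α • y) = |α| * dist x y
  dist_add_add_le : ∀ x y z : X, dist (x + z) (y + z) ≤ dist x y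

/-- An `L`-space is isotropic if its metric is translation invariant. -/
def IsIsotropic (X : Type*) [MetricSpace X] [AddCommMonoid X] : Prop :=
  ∀ x y z : X, dist (x + z) (y + z) = dist x y

/-- The set `X^c` of convex elements. -/
def convexElements (X : Type*) [AddCommMonoid X] [DistribMulAction ℝ X] : Set X :=
  {x | ∀ α β : ℝ, 0 ≤ α → 0 ≤ β → (α + β) • x = α • x + β • x}

/-- A convexifying operator: a nonexpansive linear projection of `X` onto `X^c`. -/
structure IsConvexifying {X : Type*} [MetricSpace X] [AddCommMonoid X] [DistribMulAction ℝ X]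
    (P : X → X) : Prop where
  range_eq : Set.range P = convexElements X
  dist_le : ∀ x y : X, dist (P x) (P y) ≤ dist x y
  idem : ∀ x : X, P (P x) = P x
  map_lin : ∀ (α β : ℝ) (x y : X), P (α • x + β • y) = α • P x + β • P y

/-- A modulus of continuity; only its values on `[0, ∞)` matter. -/
structure IsModulusOfContinuity (ω : ℝ → ℝ) : Prop where
  zero : ω 0 = 0
  mono : MonotoneOn ω (Ici 0)
  cont : ContinuousOn ω (Ici 0)
  subadd : ∀ s u : ℝ, 0 ≤ s → 0 ≤ u → ω (s + u) ≤ ω s + ω u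

noncomputable section

section Difference

variable {X : Type*} [AddCommMonoid X]

/-- The Hukuhara type difference `x -_H y` exists. -/
def HukuharaDiffExists (x y : X) : Prop := ∃ z : X, x = y + z

open Classical in
/-- The Hukuhara type difference `x -_H y`: the `z` with `x = y + z` (unique in an isotropic
`L`-space), with the default value `0` when there is none. -/
def hukuharaDiff (x y : X) : X :=
  if h : HukuharaDiffExists x y then h.choose else 0

end Difference

section LSpaces

variable {X : Type*} [MetricSpace X] [AddCommMonoid X] [DistribMulAction ℝ X]

/-- `d` is the Hukuhara type derivative at `t` of the function `f` on `[a, b]`; at an endpoint only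
one of the two one-sided conditions is imposed. -/
def HasHukuharaDerivAt (a b : ℝ) (f : ℝ → X) (t : ℝ) (d : X) : Prop :=
  (t < b →
    (∀ᶠ γ in 𝓝[>] (0 : ℝ), HukuharaDiffExists (f (t + γ)) (f t)) ∧
    Tendsto (fun γ : ℝ => γ⁻¹ • hukuharaDiff (f (t + γ)) (f t)) (𝓝[>] 0) (𝓝 d)) ∧
  (a < t →
    (∀ᶠ γ in 𝓝[>] (0 : ℝ), HukuharaDiffExists (f t) (f (t - γ))) ∧
    Tendsto (fun γ : ℝ => γ⁻¹ • hukuharaDiff (f t) (f (t - γ))) (𝓝[>] 0) (𝓝 d))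

open Classical in
/-- The Hukuhara type derivative `D_H f (t)`, with the default value `0` when it does not exist. -/
def hukuharaDeriv (a b : ℝ) (f : ℝ → X) (t : ℝ) : X :=
  if h : ∃ d, HasHukuharaDerivAt a b f t d then h.choose else 0

/-- The divided difference `Δ^H_{γ₁,γ₂} f (t)` of Hukuhara type. -/
def hukuharaDividedDiff (γ₁ γ₂ : ℝ) (f : ℝ → X) (t : ℝ) : X :=
  (γ₁ + γ₂)⁻¹ • hukuharaDiff (f (t + γ₂)) (f (t - γ₁))

/-- The integral over `[a, b]` of a simple function: `∑ μ(T_y) P(y)` over its values `y`. -/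
def simpleLIntegral (P : X → X) (s : SimpleFunc ℝ X) (a b : ℝ) : X :=
  ∑ y ∈ s.range, (volume.real (s ⁻¹' {y} ∩ Icc a b)) • P y

/-- `v` is the Lebesgue integral of `f` over `[a, b]`: the limit of the integrals of simple
functions that converge to `f` uniformly on `[a, b]`. -/
def IsLIntegral (P : X → X) (f : ℝ → X) (a b : ℝ) (v : X) : Prop :=
  ∃ s : ℕ → SimpleFunc ℝ X,
    TendstoUniformlyOn (fun n u => s n u) f atTop (Icc a b) ∧
    Tendsto (fun n => simpleLIntegral P (s n) a b) atTop (𝓝 v)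

open Classical in
/-- The Lebesgue integral of `f` over `[a, b]` with respect to the convexifying operator `P`,
with the default value `0` when it does not exist (it exists for every continuous `f`). -/
def lSpaceIntegral (P : X → X) (f : ℝ → X) (a b : ℝ) : X :=
  if h : ∃ v, IsLIntegral P f a b v then h.choose else 0

/-- The class `H^ω([a,b], X)`. -/
def HClass (ω : ℝ → ℝ) (a b : ℝ) (X : Type*) [MetricSpace X] : Set (ℝ → X) :=
  {φ | ∀ s ∈ Icc a b, ∀ u ∈ Icc a b, dist (φ s) (φ u) ≤ ω |s - u|}

/-- The class `W¹H^ω([a,b], X)`. -/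
def W1HClass (P : X → X) (ω : ℝ → ℝ) (a b : ℝ) : Set (ℝ → X) :=
  {f | ∃ x ∈ convexElements X, ∃ φ ∈ HClass ω a b X,
    ∀ u ∈ Icc a b, f u = x + lSpaceIntegral P φ a u}

/-- The class `⋃_{k > 0} k · W¹H^ω([a,b], X)`. -/
def W1HBarClass (P : X → X) (ω : ℝ → ℝ) (a b : ℝ) : Set (ℝ → X) :=
  {f | ∃ k : ℝ, 0 < k ∧ ∃ g ∈ W1HClass P ω a b, ∀ u ∈ Icc a b, f u = k • g u}

/-- The set of ratios whose supremum is `‖g‖_ω`. -/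
def omegaRatios (ω : ℝ → ℝ) (a b : ℝ) (g : ℝ → X) : Set ℝ :=
  {r | ∃ s ∈ Icc a b, ∃ u ∈ Icc a b, s ≠ u ∧ r = dist (g s) (g u) / ω |s - u|}

/-- The quantity `‖g‖_{ω, X}` of a function `g` on `[a, b]`. -/
def omegaNorm (ω : ℝ → ℝ) (a b : ℝ) (g : ℝ → X) : ℝ :=
  sSup (omegaRatios ω a b g)

end LSpaces

/-- `I(α) = ∫₀^α ω`. -/
def modulusIntegral (ω : ℝ → ℝ) (α : ℝ) : ℝ := ∫ s in (0 : ℝ)..α, ω s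

/-- The constant `K(γ₁,γ₂;h₁,h₂)`. For `γ₁ = h₁`, `γ₂ = h₂` it is `0`. -/
def landauK (ω : ℝ → ℝ) (γ₁ γ₂ h₁ h₂ : ℝ) : ℝ :=
  ((h₁ - γ₁) + (h₂ - γ₂)) / (h₁ + h₂) ^ 2 *
    (modulusIntegral ω ((h₁ + h₂) * (h₁ - γ₁) / ((h₁ - γ₁) + (h₂ - γ₂))) +
      modulusIntegral ω ((h₁ + h₂) * (h₂ - γ₂) / ((h₁ - γ₁) + (h₂ - γ₂))))

end

/-! The convex elements form a cone over the non-negative reals with a translation invariant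
homogeneous metric. Such a cone embeds isometrically into a Banach space, the completion of its
Grothendieck group. There the integral of a continuous `φ` is the ordinary integral of the image of
`P ∘ φ` (`IsConvexifying.envelopeRep_lSpaceIntegral`). So each `f` in the class is represented by a
continuous Banach-valued density `G`: its derivative is `G`, and its divided differences are
averages of `G` (`HasDensity`).

For (1), `average_sub_average` writes the difference of the averages over an interval and a larger
one as an integral of differences of `G` at paired points. The pairs come from dilations about the
two endpoints, and the points of a pair are `(h₁ + h₂) * s` apart, so integrating the modulus gives
`landauK`. For (2), one averages `G t - G u` over `u`.

For sharpness, a scalar function `C + ψ ≥ 0` times a unit convex element turns every norm into a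
scalar average. For (2), `ψ u = -ω |t - u|` works for any modulus. For (1), `ψ` must attain the
modulus on all the pairs at once. It is glued from two reflected copies of `extremalProfile`, whose
two branches are weighted so that concavity of `ω` keeps the increments below `ω`. -/

open scoped NNReal

/-! ### The Banach space generated by an isometric cone -/

/-- A semimodule over the non-negative reals with a translation invariant homogeneous metric. -/
class IsIsometricCone (M : Type*) [MetricSpace M] [AddCommMonoid M] [Module ℝ≥0 M] : Prop where
  dist_add_right : ∀ x y z : M, dist (x + z) (y + z) = dist x y
  dist_smul : ∀ (r : ℝ≥0) (x y : M), dist (r • x) (r • y) = r * dist x y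

namespace IsIsometricCone

open Algebra

theorem exists_eq_of_sub_of {M : Type*} [AddCommMonoid M] (x : GrothendieckAddGroup M) :
    ∃ a b : M, x = GrothendieckAddGroup.of a - GrothendieckAddGroup.of b := by
  induction x using AddLocalization.ind with
  | H y =>
    refine ⟨y.1, y.2, ?_⟩
    change _ = AddLocalization.addMonoidOf ⊤ y.1 - AddLocalization.addMonoidOf ⊤ (y.2 : M)
    rw [← AddLocalization.mk_zero_eq_addMonoidOf_mk, ← AddLocalization.mk_zero_eq_addMonoidOf_mk,
      GrothendieckAddGroup.mk_sub_mk]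
    congr 1
    · simp
    · ext; simp

section Module

variable {M : Type*} [AddCommMonoid M] [Module ℝ≥0 M]

/-- The action of a non-negative scalar on the Grothendieck group. -/
noncomputable def nnsmulHom (r : ℝ≥0) : GrothendieckAddGroup M →+ GrothendieckAddGroup M :=
  GrothendieckAddGroup.lift
    ((GrothendieckAddGroup.of (M := M)).comp (DistribSMul.toAddMonoidHom M r))

@[simp]
theorem nnsmulHom_of (r : ℝ≥0) (a : M) :
    nnsmulHom r (GrothendieckAddGroup.of a) = GrothendieckAddGroup.of (r • a) := by
  have := DFunLike.congr_fun (GrothendieckAddGroup.lift.symm_apply_apply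
    ((GrothendieckAddGroup.of (M := M)).comp (DistribSMul.toAddMonoidHom M r))) a
  exact this

theorem nnsmulHom_add (r s : ℝ≥0) (x : GrothendieckAddGroup M) :
    nnsmulHom (r + s) x = nnsmulHom r x + nnsmulHom s x := by
  obtain ⟨a, b, rfl⟩ := exists_eq_of_sub_of x
  simp only [map_sub, nnsmulHom_of, add_smul, map_add]
  abel

theorem nnsmulHom_mul (r s : ℝ≥0) (x : GrothendieckAddGroup M) :
    nnsmulHom (r * s) x = nnsmulHom r (nnsmulHom s x) := by
  obtain ⟨a, b, rfl⟩ := exists_eq_of_sub_of x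
  simp only [map_sub, nnsmulHom_of, mul_smul]

theorem nnsmulHom_one (x : GrothendieckAddGroup M) : nnsmulHom 1 x = x := by
  obtain ⟨a, b, rfl⟩ := exists_eq_of_sub_of x
  simp only [map_sub, nnsmulHom_of, one_smul]

theorem nnsmulHom_zero (x : GrothendieckAddGroup M) : nnsmulHom 0 x = 0 := by
  obtain ⟨a, b, rfl⟩ := exists_eq_of_sub_of x
  simp only [map_sub, nnsmulHom_of, zero_smul, sub_self]

noncomputable instance : SMul ℝ (GrothendieckAddGroup M) where
  smul r x := nnsmulHom r.toNNReal x - nnsmulHom (-r).toNNReal x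

theorem real_smul_def (r : ℝ) (x : GrothendieckAddGroup M) :
    r • x = nnsmulHom r.toNNReal x - nnsmulHom (-r).toNNReal x := rfl

/-- Since `nnsmulHom` is additive in the scalar, it does not matter how a real is split into a
difference of non-negative reals. The module axioms below thus reduce to identities over `ℝ≥0`. -/
theorem sub_smul_eq (p q : ℝ≥0) (x : GrothendieckAddGroup M) :
    ((p : ℝ) - q) • x = nnsmulHom p x - nnsmulHom q x := by
  rw [real_smul_def, sub_eq_sub_iff_add_eq_add, ← nnsmulHom_add, ← nnsmulHom_add]
  congr 2
  apply NNReal.coe_injective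
  simp only [NNReal.coe_add, Real.coe_toNNReal']
  rcases le_total (p : ℝ) q with h | h
  · rw [max_eq_right (by linarith), max_eq_left (by linarith)]; ring
  · rw [max_eq_left (by linarith), max_eq_right (by linarith)]; ring

theorem coe_smul_eq (p : ℝ≥0) (x : GrothendieckAddGroup M) : (p : ℝ) • x = nnsmulHom p x := by
  have := sub_smul_eq p 0 x
  simpa [nnsmulHom_zero] using this

theorem exists_eq_coe_sub_coe (r : ℝ) : ∃ p q : ℝ≥0, r = (p : ℝ) - q :=
  ⟨r.toNNReal, (-r).toNNReal, by
    simp only [Real.coe_toNNReal']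
    rcases le_total r 0 with h | h
    · rw [max_eq_right h, max_eq_left (by linarith)]; ring
    · rw [max_eq_left h, max_eq_right (by linarith)]; ring⟩

noncomputable instance : Module ℝ (GrothendieckAddGroup M) where
  one_smul x := by simpa [nnsmulHom_one] using coe_smul_eq 1 x
  zero_smul x := by simpa [nnsmulHom_zero] using coe_smul_eq 0 x
  smul_zero r := by simp [real_smul_def]
  smul_add r x y := by simp only [real_smul_def, map_add]; abel
  add_smul r s x := by
    obtain ⟨p, q, rfl⟩ := exists_eq_coe_sub_coe r
    obtain ⟨p', q', rfl⟩ := exists_eq_coe_sub_coe s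
    have : ((p : ℝ) - q) + (p' - q') = ((p + p' : ℝ≥0) : ℝ) - ((q + q' : ℝ≥0) : ℝ) := by
      push_cast; ring
    rw [this, sub_smul_eq, sub_smul_eq, sub_smul_eq, nnsmulHom_add, nnsmulHom_add]
    abel
  mul_smul r s x := by
    obtain ⟨p, q, rfl⟩ := exists_eq_coe_sub_coe r
    obtain ⟨p', q', rfl⟩ := exists_eq_coe_sub_coe s
    have : ((p : ℝ) - q) * (p' - q') =
        ((p * p' + q * q' : ℝ≥0) : ℝ) - ((p * q' + q * p' : ℝ≥0) : ℝ) := by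
      push_cast; ring
    rw [this, sub_smul_eq, sub_smul_eq, sub_smul_eq, nnsmulHom_add, nnsmulHom_add]
    simp only [nnsmulHom_mul, map_sub]
    abel

end Module

variable {M : Type*} [MetricSpace M] [AddCommMonoid M] [Module ℝ≥0 M] [IsIsometricCone M]

/-- Translation invariance lets one add `d` to the first pair and `b` to the second. This makes the
norm on formal differences independent of the representatives. -/
theorem dist_eq_of_add_eq {a b c d : M} (h : a + d = c + b) : dist a b = dist c d := by
  rw [← dist_add_right a b d, h, add_comm b d, dist_add_right]

theorem add_right_cancel_of_isometricCone {a b c : M} (h : a + c = b + c) : a = b := by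
  rw [← dist_eq_zero, ← dist_add_right a b c, h, dist_self]

theorem of_sub_of_eq_iff {a b c d : M} :
    (GrothendieckAddGroup.of a - GrothendieckAddGroup.of b : GrothendieckAddGroup M) =
      GrothendieckAddGroup.of c - GrothendieckAddGroup.of d ↔ a + d = c + b := by
  have : IsCancelAdd M :=
    { add_left_cancel := fun a b c h => add_right_cancel_of_isometricCone (c := a) (by
        simpa only [add_comm a] using h)
      add_right_cancel := fun a b c h => add_right_cancel_of_isometricCone h }
  rw [sub_eq_sub_iff_add_eq_add, ← map_add, ← map_add]
  exact GrothendieckAddGroup.of_injective.eq_iff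

/-- The distance of the two components of a formal difference. -/
noncomputable def grothendieckNorm (x : GrothendieckAddGroup M) : ℝ :=
  dist (exists_eq_of_sub_of x).choose (exists_eq_of_sub_of x).choose_spec.choose

theorem grothendieckNorm_of_sub_of (a b : M) :
    grothendieckNorm (GrothendieckAddGroup.of a - GrothendieckAddGroup.of b) = dist a b :=
  (dist_eq_of_add_eq (of_sub_of_eq_iff.1 (exists_eq_of_sub_of
    (GrothendieckAddGroup.of a - GrothendieckAddGroup.of b)).choose_spec.choose_spec)).symm

noncomputable instance : NormedAddCommGroup (GrothendieckAddGroup M) :=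
  AddGroupNorm.toNormedAddCommGroup
    { toFun := grothendieckNorm
      map_zero' := by
        have := grothendieckNorm_of_sub_of (0 : M) 0
        simpa using this
      add_le' := fun x y => by
        obtain ⟨a, b, rfl⟩ := exists_eq_of_sub_of x
        obtain ⟨c, d, rfl⟩ := exists_eq_of_sub_of y
        rw [sub_add_sub_comm, ← map_add, ← map_add]
        simp only [grothendieckNorm_of_sub_of]
        calc dist (a + c) (b + d) ≤ dist (a + c) (b + c) + dist (b + c) (b + d) :=
              dist_triangle _ _ _
          _ = dist a b + dist c d := by
              rw [dist_add_right, add_comm b c, add_comm b d, dist_add_right]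
      neg' := fun x => by
        obtain ⟨a, b, rfl⟩ := exists_eq_of_sub_of x
        rw [neg_sub]
        simp only [grothendieckNorm_of_sub_of, dist_comm]
      eq_zero_of_map_eq_zero' := fun x hx => by
        obtain ⟨a, b, rfl⟩ := exists_eq_of_sub_of x
        rw [grothendieckNorm_of_sub_of, dist_eq_zero] at hx
        rw [hx, sub_self] }

theorem norm_of_sub_of (a b : M) :
    ‖(GrothendieckAddGroup.of a - GrothendieckAddGroup.of b : GrothendieckAddGroup M)‖ = dist a b :=
  grothendieckNorm_of_sub_of a b

theorem norm_nnsmulHom (p : ℝ≥0) (x : GrothendieckAddGroup M) : ‖nnsmulHom p x‖ = p * ‖x‖ := by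
  obtain ⟨a, b, rfl⟩ := exists_eq_of_sub_of x
  simp only [map_sub, nnsmulHom_of, norm_of_sub_of, dist_smul]

noncomputable instance : NormedSpace ℝ (GrothendieckAddGroup M) where
  norm_smul_le r x := by
    rcases le_total 0 r with h | h
    · lift r to ℝ≥0 using h
      rw [coe_smul_eq, norm_nnsmulHom, Real.norm_eq_abs, NNReal.abs_eq]
    · obtain ⟨s, rfl⟩ : ∃ s : ℝ≥0, r = -s := 
        ⟨(-r).toNNReal, by rw [Real.coe_toNNReal _ (by linarith), neg_neg]⟩
      rw [neg_smul, norm_neg, coe_smul_eq, norm_nnsmulHom, norm_neg, Real.norm_eq_abs,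
        NNReal.abs_eq]

variable (M) in
/-- The Banach space generated by an isometric cone. -/
abbrev Envelope : Type _ := UniformSpace.Completion (GrothendieckAddGroup M)

/-- The embedding of an isometric cone into the Banach space that it generates. -/
noncomputable def embed (x : M) : Envelope M :=
  ((GrothendieckAddGroup.of x : GrothendieckAddGroup M) : UniformSpace.Completion _)

theorem embed_add (x y : M) : embed (x + y) = embed x + embed y := by
  simp only [embed, map_add, UniformSpace.Completion.coe_add]

theorem embed_zero : embed (0 : M) = 0 := by
  simp only [embed, map_zero, UniformSpace.Completion.coe_zero]

theorem embed_smul (r : ℝ≥0) (x : M) : embed (r • x) = (r : ℝ) • embed x := by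
  simp only [embed, ← UniformSpace.Completion.coe_smul, coe_smul_eq, nnsmulHom_of]

theorem isometry_embed : Isometry (embed : M → Envelope M) :=
  UniformSpace.Completion.coe_isometry.comp <| Isometry.of_dist_eq fun a b => by
    rw [dist_eq_norm, norm_of_sub_of]

end IsIsometricCone

open IsIsometricCone

/-! ### The cone of convex elements and its envelope -/

section ConvexElements

variable {X : Type*} [AddCommMonoid X] [DistribMulAction ℝ X]

theorem smul_mem_convexElements {x : X} (hx : x ∈ convexElements X) (r : ℝ) :
    r • x ∈ convexElements X := fun α β hα hβ => by
  rw [smul_smul, smul_smul, smul_smul, mul_comm, mul_smul, hx α β hα hβ, smul_add, smul_smul,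
    smul_smul, mul_comm r, mul_comm r]

theorem add_mem_convexElements {x y : X} (hx : x ∈ convexElements X) (hy : y ∈ convexElements X) :
    x + y ∈ convexElements X := fun α β hα hβ => by
  rw [smul_add, hx α β hα hβ, hy α β hα hβ, smul_add, smul_add, add_add_add_comm]

theorem zero_mem_convexElements : (0 : X) ∈ convexElements X := fun α β _ _ => by
  simp only [smul_zero, add_zero]

variable (X) in
/-- The convex elements as an additive submonoid. -/
def convexSubmonoid : AddSubmonoid X where
  carrier := convexElements X
  add_mem' := add_mem_convexElements
  zero_mem' := zero_mem_convexElements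

end ConvexElements

section LSpaceGeometry

variable {X : Type*} [MetricSpace X] [AddCommMonoid X] [DistribMulAction ℝ X]

theorem IsConvexifying.mem_convexElements {P : X → X} (hP : IsConvexifying P) (x : X) :
    P x ∈ convexElements X := hP.range_eq ▸ mem_range_self x

theorem IsConvexifying.apply_of_mem {P : X → X} (hP : IsConvexifying P) {x : X}
    (hx : x ∈ convexElements X) : P x = x := by
  rw [← hP.range_eq] at hx
  obtain ⟨y, rfl⟩ := hx
  exact hP.idem y

variable [LSpace X]

instance : ContinuousConstSMul ℝ X where
  continuous_const_smul r :=
    (LipschitzWith.of_dist_le_mul (K := ⟨|r|, abs_nonneg r⟩) fun x y =>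
      (LSpace.dist_smul_smul r x y).le).continuous

theorem dist_add_add_le_add (x y x' y' : X) :
    dist (x + y) (x' + y') ≤ dist x x' + dist y y' :=
  (dist_triangle _ (x' + y) _).trans <| add_le_add (LSpace.dist_add_add_le _ _ _) <| by
    rw [add_comm x' y, add_comm x' y']
    exact LSpace.dist_add_add_le _ _ _

instance : ContinuousAdd X where
  continuous_add := by
    refine (LipschitzWith.of_dist_le_mul (K := 2) fun p q => ?_).continuous
    refine (dist_add_add_le_add _ _ _ _).trans ?_
    have h1 : dist p.1 q.1 ≤ dist p q := le_max_left _ _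
    have h2 : dist p.2 q.2 ≤ dist p q := le_max_right _ _
    simp only [NNReal.coe_ofNat]
    linarith

theorem isClosed_convexElements : IsClosed (convexElements X) := by
  have : convexElements X = ⋂ (α : ℝ) (β : ℝ) (_ : 0 ≤ α) (_ : 0 ≤ β),
      {x : X | (α + β) • x = α • x + β • x} := by
    ext x; simp [convexElements]
  rw [this]
  refine isClosed_iInter fun α => isClosed_iInter fun β => isClosed_iInter fun _ =>
    isClosed_iInter fun _ => isClosed_eq (continuous_const_smul _) ?_
  exact (continuous_const_smul α).add (continuous_const_smul β)

/-- Convexity is exactly the distributivity that `X` lacks, and it concerns non-negative scalars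
only; hence `ℝ≥0` rather than `ℝ`. -/
noncomputable instance : Module ℝ≥0 (convexSubmonoid X) where
  smul r x := ⟨(r : ℝ) • (x : X), smul_mem_convexElements x.2 r⟩
  one_smul x := Subtype.ext (one_smul ℝ (x : X))
  mul_smul r s x := Subtype.ext (mul_smul (r : ℝ) (s : ℝ) (x : X))
  smul_zero r := Subtype.ext (smul_zero (r : ℝ))
  smul_add r x y := Subtype.ext (smul_add (r : ℝ) (x : X) (y : X))
  add_smul r s x := Subtype.ext (x.2 (r : ℝ) (s : ℝ) r.2 s.2)
  zero_smul x := Subtype.ext (LSpace.zero_smul_eq (x : X))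

variable [Fact (IsIsotropic X)]

instance : IsIsometricCone (convexSubmonoid X) where
  dist_add_right x y z := (Fact.out : IsIsotropic X) (x : X) y z
  dist_smul r x y := (LSpace.dist_smul_smul (r : ℝ) (x : X) y).trans (by rw [NNReal.abs_eq]; rfl)

/-- The element `x` is convex and `e` is its image in the envelope of the cone of convex
elements. -/
def EnvelopeRep (x : X) (e : Envelope (convexSubmonoid X)) : Prop :=
  ∃ hx : x ∈ convexElements X, embed (⟨x, hx⟩ : convexSubmonoid X) = e

namespace EnvelopeRep

variable {x y : X} {e e' : Envelope (convexSubmonoid X)}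

theorem mem (h : EnvelopeRep x e) : x ∈ convexElements X := h.1

theorem zero : EnvelopeRep (0 : X) 0 := ⟨zero_mem_convexElements, embed_zero⟩

theorem add (h : EnvelopeRep x e) (h' : EnvelopeRep y e') : EnvelopeRep (x + y) (e + e') := by
  obtain ⟨hx, rfl⟩ := h
  obtain ⟨hy, rfl⟩ := h'
  exact ⟨add_mem_convexElements hx hy, embed_add (⟨x, hx⟩ : convexSubmonoid X) ⟨y, hy⟩⟩

theorem smul (h : EnvelopeRep x e) {r : ℝ} (hr : 0 ≤ r) : EnvelopeRep (r • x) (r • e) := by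
  obtain ⟨hx, rfl⟩ := h
  exact ⟨smul_mem_convexElements hx r, embed_smul ⟨r, hr⟩ (⟨x, hx⟩ : convexSubmonoid X)⟩

theorem sum {ι : Type*} {s : Finset ι} {x : ι → X} {e : ι → Envelope (convexSubmonoid X)}
    (h : ∀ i ∈ s, EnvelopeRep (x i) (e i)) : EnvelopeRep (∑ i ∈ s, x i) (∑ i ∈ s, e i) := by
  classical
  induction s using Finset.induction_on with
  | empty => exact zero
  | insert i s hi ih =>
    rw [Finset.sum_insert hi, Finset.sum_insert hi]
    exact (h i (Finset.mem_insert_self i s)).add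
      (ih fun k hk => h k (Finset.mem_insert_of_mem hk))

theorem dist_eq (h : EnvelopeRep x e) (h' : EnvelopeRep y e') : dist x y = dist e e' := by
  obtain ⟨hx, rfl⟩ := h
  obtain ⟨hy, rfl⟩ := h'
  exact (isometry_embed.dist_eq (⟨x, hx⟩ : convexSubmonoid X) ⟨y, hy⟩).symm

theorem dist_zero (h : EnvelopeRep x e) : dist x 0 = ‖e‖ := by
  rw [h.dist_eq zero, dist_zero_right]

theorem eq (h : EnvelopeRep x e) (h' : EnvelopeRep y e) : x = y := by
  rw [← dist_eq_zero, h.dist_eq h', dist_self]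

theorem tendsto_iff {ι : Type*} {l : Filter ι} {x : ι → X} {e : ι → Envelope (convexSubmonoid X)}
    {x₀ : X} {e₀ : Envelope (convexSubmonoid X)} (h : ∀ᶠ i in l, EnvelopeRep (x i) (e i))
    (h₀ : EnvelopeRep x₀ e₀) : Tendsto x l (𝓝 x₀) ↔ Tendsto e l (𝓝 e₀) := by
  refine (tendsto_iff_dist_tendsto_zero.trans (tendsto_congr' ?_)).trans
    tendsto_iff_dist_tendsto_zero.symm
  filter_upwards [h] with i hi using hi.dist_eq h₀

/-- Completeness of `X` and closedness of the convex elements make the image of the cone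
sequentially closed in the envelope. Integrals computed there therefore come from elements of `X`.
-/
theorem exists_of_tendsto {x : ℕ → X} {e : ℕ → Envelope (convexSubmonoid X)}
    {e₀ : Envelope (convexSubmonoid X)} (h : ∀ i, EnvelopeRep (x i) (e i))
    (he : Tendsto e atTop (𝓝 e₀)) : ∃ x₀, Tendsto x atTop (𝓝 x₀) ∧ EnvelopeRep x₀ e₀ := by
  have hc : CauchySeq x := by
    have := he.cauchySeq
    rw [Metric.cauchySeq_iff] at this ⊢
    simpa only [(h _).dist_eq (h _)] using this
  obtain ⟨x₀, hx₀⟩ := cauchySeq_tendsto_of_complete hc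
  have hm : x₀ ∈ convexElements X :=
    isClosed_convexElements.mem_of_tendsto hx₀ (Eventually.of_forall fun i => (h i).mem)
  refine ⟨x₀, hx₀, hm, tendsto_nhds_unique ?_ he⟩
  exact (tendsto_iff (Eventually.of_forall h) ⟨hm, rfl⟩).1 hx₀

end EnvelopeRep

end LSpaceGeometry

/-! ### The integral in `X` as a Bochner integral in the envelope -/

section Integral

variable {X : Type*} [MetricSpace X] [AddCommMonoid X] [DistribMulAction ℝ X] [LSpace X]
  [Fact (IsIsotropic X)] {P : X → X}

/-- The image of `P x` in the envelope of the cone of convex elements. -/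
noncomputable def IsConvexifying.toEnvelope (hP : IsConvexifying P) (x : X) :
    Envelope (convexSubmonoid X) :=
  embed (⟨P x, hP.mem_convexElements x⟩ : convexSubmonoid X)

theorem IsConvexifying.envelopeRep (hP : IsConvexifying P) (x : X) :
    EnvelopeRep (P x) (hP.toEnvelope x) := ⟨hP.mem_convexElements x, rfl⟩

theorem IsConvexifying.dist_toEnvelope_le (hP : IsConvexifying P) (x y : X) :
    dist (hP.toEnvelope x) (hP.toEnvelope y) ≤ dist x y := by
  rw [← (hP.envelopeRep x).dist_eq (hP.envelopeRep y)]
  exact hP.dist_le x y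

theorem IsConvexifying.continuous_toEnvelope (hP : IsConvexifying P) :
    Continuous hP.toEnvelope :=
  (LipschitzWith.of_dist_le_mul (K := 1) fun x y => by
    simpa using hP.dist_toEnvelope_le x y).continuous

theorem MeasureTheory.SimpleFunc.comp_eq_sum_indicator {X E : Type*} [AddCommMonoid E]
    (s : SimpleFunc ℝ X) (g : X → E) (u : ℝ) :
    g (s u) = ∑ y ∈ s.range, (s ⁻¹' {y}).indicator (fun _ => g y) u := by
  classical
  rw [Finset.sum_eq_single (s u)]
  · simp
  · intro y _ hy
    exact indicator_of_notMem (fun h => hy (by simpa using h.symm)) _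
  · intro h
    exact absurd (s.mem_range_self u) h

theorem IsConvexifying.integrableOn_simpleFunc (hP : IsConvexifying P) (s : SimpleFunc ℝ X)
    (a b : ℝ) : IntegrableOn (fun u => hP.toEnvelope (s u)) (Icc a b) := by
  simp_rw [s.comp_eq_sum_indicator hP.toEnvelope]
  refine integrable_finsetSum _ fun y _ => ?_
  exact (integrable_const _).indicator (s.measurableSet_fiber y)

theorem IsConvexifying.envelopeRep_simpleLIntegral (hP : IsConvexifying P) (s : SimpleFunc ℝ X)
    (a b : ℝ) :
    EnvelopeRep (simpleLIntegral P s a b) (∫ u in Icc a b, hP.toEnvelope (s u)) := by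
  have : ∫ u in Icc a b, hP.toEnvelope (s u) =
      ∑ y ∈ s.range, (volume.real (s ⁻¹' {y} ∩ Icc a b)) • hP.toEnvelope y := by
    simp_rw [s.comp_eq_sum_indicator hP.toEnvelope]
    rw [integral_finsetSum _ fun y _ => (integrable_const _).indicator (s.measurableSet_fiber y)]
    refine Finset.sum_congr rfl fun y _ => ?_
    rw [integral_indicator_const _ (s.measurableSet_fiber y),
      measureReal_restrict_apply (s.measurableSet_fiber y)]
  rw [this]
  exact EnvelopeRep.sum fun y _ => (hP.envelopeRep y).smul measureReal_nonneg

theorem tendsto_setIntegral_of_tendstoUniformlyOn {E : Type*} [NormedAddCommGroup E]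
    [NormedSpace ℝ E] {F : ℕ → ℝ → E} {f : ℝ → E} {a b : ℝ}
    (hF : ∀ n, IntegrableOn (F n) (Icc a b)) (hf : IntegrableOn f (Icc a b))
    (h : TendstoUniformlyOn F f atTop (Icc a b)) :
    Tendsto (fun n => ∫ u in Icc a b, F n u) atTop (𝓝 (∫ u in Icc a b, f u)) := by
  rw [Metric.tendsto_nhds]
  intro ε hε
  set c := volume.real (Icc a b) with hc
  have hc0 : 0 ≤ c := measureReal_nonneg
  rw [Metric.tendstoUniformlyOn_iff] at h
  -- The `+ 1` covers an interval of measure zero.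
  filter_upwards [h (ε / (c + 1)) (by positivity)] with n hn
  rw [dist_eq_norm, ← integral_sub (hF n) hf]
  have := norm_setIntegral_le_of_norm_le_const (μ := volume) (s := Icc a b)
    (f := fun u => F n u - f u) (C := ε / (c + 1)) measure_Icc_lt_top
    (fun u hu => by rw [← dist_eq_norm, dist_comm]; exact (hn u hu).le)
  refine this.trans_lt ?_
  rw [← hc, div_mul_eq_mul_div, div_lt_iff₀ (by positivity)]
  nlinarith

theorem exists_simpleFunc_near {a b : ℝ} (hab : a ≤ b) {δ : ℝ} (hδ : 0 < δ) :
    ∃ ρ : SimpleFunc ℝ ℝ, ∀ u ∈ Icc a b, ρ u ∈ Icc a b ∧ dist (ρ u) u < δ := by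
  -- Clamping to `[a, b]` gives the rounding map finite range on all of `ℝ`. Rounding down keeps its
  -- values in `[a, b]`, so `φ` is later evaluated only where it is known to be continuous.
  let c : ℝ → ℝ := fun u => (max a (min u b) - a) / δ
  have hc : Measurable c := by fun_prop
  let k : SimpleFunc ℝ ℕ :=
    { toFun := fun u => ⌊c u⌋₊
      measurableSet_fiber' := fun n =>
        (Nat.measurable_floor.comp hc) (measurableSet_singleton n)
      finite_range' := by
        refine (Set.finite_Iic ⌊(b - a) / δ⌋₊).subset ?_
        rintro _ ⟨u, rfl⟩
        refine Nat.floor_le_floor ?_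
        simp only [c]
        gcongr
        exact max_le hab (min_le_right _ _) }
  refine ⟨k.map fun n : ℕ => a + n * δ, fun u hu => ?_⟩
  have hcu : c u = (u - a) / δ := by
    simp only [c]; rw [min_eq_left hu.2, max_eq_right hu.1]
  have h0 : 0 ≤ c u := by rw [hcu]; exact div_nonneg (by linarith [hu.1]) hδ.le
  have h1 : ((⌊c u⌋₊ : ℕ) : ℝ) * δ ≤ u - a := by
    rw [← le_div_iff₀ hδ, ← hcu]; exact Nat.floor_le h0
  have h2 : u - a < ((⌊c u⌋₊ : ℕ) + 1 : ℝ) * δ := by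
    rw [← div_lt_iff₀ hδ, ← hcu]; exact Nat.lt_floor_add_one _
  have h3 : 0 ≤ ((⌊c u⌋₊ : ℕ) : ℝ) * δ := by positivity
  have h4 : (k.map fun n : ℕ => a + n * δ) u = a + ((⌊c u⌋₊ : ℕ) : ℝ) * δ := rfl
  rw [h4]
  refine ⟨⟨by linarith, by linarith [hu.2]⟩, ?_⟩
  rw [Real.dist_eq, abs_lt]
  constructor <;> linarith

theorem exists_tendstoUniformlyOn_simpleFunc {X : Type*} [MetricSpace X] {φ : ℝ → X} {a b : ℝ}
    (hab : a ≤ b) (hφ : ContinuousOn φ (Icc a b)) :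
    ∃ s : ℕ → SimpleFunc ℝ X, TendstoUniformlyOn (fun n u => s n u) φ atTop (Icc a b) := by
  choose ρ hρ using fun n : ℕ =>
    exists_simpleFunc_near hab (δ := 1 / ((n : ℝ) + 1)) Nat.one_div_pos_of_nat
  refine ⟨fun n => (ρ n).map φ, ?_⟩
  rw [Metric.tendstoUniformlyOn_iff]
  intro ε hε
  obtain ⟨δ, hδ, h⟩ := Metric.uniformContinuousOn_iff.1
    (isCompact_Icc.uniformContinuousOn_of_continuous hφ) ε hε
  filter_upwards [tendsto_one_div_add_atTop_nhds_zero_nat.eventually (gt_mem_nhds hδ)] with n hn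
  intro u hu
  exact h u hu (ρ n u) (hρ n u hu).1 (by rw [dist_comm]; exact (hρ n u hu).2.trans hn)

/-- The limit is identified in the envelope independently of the approximating sequence `s`, so the
value chosen in `lSpaceIntegral` is the only one possible. -/
theorem IsConvexifying.envelopeRep_of_isLIntegral (hP : IsConvexifying P) {φ : ℝ → X} {a b : ℝ}
    (hφ : ContinuousOn φ (Icc a b)) {s : ℕ → SimpleFunc ℝ X}
    (hs : TendstoUniformlyOn (fun n u => s n u) φ atTop (Icc a b)) :
    ∃ v, Tendsto (fun n => simpleLIntegral P (s n) a b) atTop (𝓝 v) ∧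
      EnvelopeRep v (∫ u in Icc a b, hP.toEnvelope (φ u)) := by
  refine EnvelopeRep.exists_of_tendsto (fun n => hP.envelopeRep_simpleLIntegral (s n) a b) ?_
  refine tendsto_setIntegral_of_tendstoUniformlyOn (fun n => hP.integrableOn_simpleFunc _ _ _)
    ((hP.continuous_toEnvelope.comp_continuousOn hφ).integrableOn_Icc) ?_
  rw [Metric.tendstoUniformlyOn_iff] at hs ⊢
  intro ε hε
  filter_upwards [hs ε hε] with n hn u hu
  exact (hP.dist_toEnvelope_le _ _).trans_lt (hn u hu)

theorem IsConvexifying.envelopeRep_lSpaceIntegral (hP : IsConvexifying P) {φ : ℝ → X} {a b : ℝ}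
    (hab : a ≤ b) (hφ : ContinuousOn φ (Icc a b)) :
    EnvelopeRep (lSpaceIntegral P φ a b) (∫ u in a..b, hP.toEnvelope (φ u)) := by
  rw [intervalIntegral.integral_of_le hab, ← integral_Icc_eq_integral_Ioc]
  have hex : ∃ v, IsLIntegral P φ a b v := by
    obtain ⟨s, hs⟩ := exists_tendstoUniformlyOn_simpleFunc hab hφ
    obtain ⟨v, hv, -⟩ := hP.envelopeRep_of_isLIntegral hφ hs
    exact ⟨v, s, hs, hv⟩
  rw [lSpaceIntegral, dif_pos hex]
  obtain ⟨s, hs, hv⟩ := hex.choose_spec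
  obtain ⟨v, hv', hr⟩ := hP.envelopeRep_of_isLIntegral hφ hs
  rwa [tendsto_nhds_unique hv hv']

end Integral

/-! ### Moduli of continuity and the constant `landauK` -/

namespace IsModulusOfContinuity

variable {ω : ℝ → ℝ}

theorem nonneg (hω : IsModulusOfContinuity ω) {s : ℝ} (hs : 0 ≤ s) : 0 ≤ ω s :=
  hω.zero ▸ hω.mono self_mem_Ici hs hs

/-- One zero at `s > 0` spreads to all multiples of `s` by semi-additivity and then everywhere by
monotonicity. The denominators in `omegaRatios` are therefore positive. -/
theorem pos (hω : IsModulusOfContinuity ω) (h0 : ∃ s : ℝ, 0 ≤ s ∧ ω s ≠ 0) {s : ℝ}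
    (hs : 0 < s) : 0 < ω s := by
  refine (hω.nonneg hs.le).lt_of_ne' fun h => ?_
  obtain ⟨r, hr, hne⟩ := h0
  have hn : ∀ n : ℕ, ω (n * s) ≤ 0 := by
    intro n
    induction n with
    | zero => simp [hω.zero]
    | succ n ih =>
      push_cast
      rw [add_mul, one_mul]
      linarith [hω.subadd (n * s) s (by positivity) hs.le]
  obtain ⟨n, hrn⟩ := Archimedean.arch r hs
  rw [nsmul_eq_mul] at hrn
  exact hne (le_antisymm ((hω.mono hr (hr.trans hrn) hrn).trans (hn n)) (hω.nonneg hr))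

theorem continuous_abs (hω : IsModulusOfContinuity ω) : Continuous fun s => ω |s| :=
  hω.cont.comp_continuous _root_.continuous_abs fun s => abs_nonneg s

theorem abs_sub_le (hω : IsModulusOfContinuity ω) {x y : ℝ} (hx : 0 ≤ x) (hy : 0 ≤ y) :
    |ω x - ω y| ≤ ω |x - y| := by
  wlog h : y ≤ x generalizing x y
  · rw [abs_sub_comm, abs_sub_comm x]
    exact this hy hx (le_of_not_ge h)
  rw [abs_of_nonneg (sub_nonneg.2 (hω.mono hy hx h)), abs_of_nonneg (sub_nonneg.2 h)]
  have := hω.subadd y (x - y) hy (sub_nonneg.2 h)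
  rw [add_sub_cancel] at this
  linarith

theorem abs_sub_abs_le (hω : IsModulusOfContinuity ω) (x y : ℝ) :
    abs (ω |x| - ω |y|) ≤ ω |x - y| :=
  (hω.abs_sub_le (abs_nonneg x) (abs_nonneg y)).trans
    (hω.mono (mem_Ici.2 (abs_nonneg _)) (mem_Ici.2 (abs_nonneg _)) (abs_abs_sub_abs_le_abs_sub x y))

theorem modulusIntegral_eq {α : ℝ} (hα : 0 ≤ α) :
    modulusIntegral ω α = ∫ s in (0 : ℝ)..α, ω |s| := by
  refine intervalIntegral.integral_congr fun s hs => ?_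
  rw [uIcc_of_le hα] at hs
  simp only [abs_of_nonneg hs.1]

theorem integral_abs_sub (hω : IsModulusOfContinuity ω) (t : ℝ) {h₁ h₂ : ℝ} (hh₁ : 0 ≤ h₁)
    (hh₂ : 0 ≤ h₂) :
    ∫ u in (t - h₁)..(t + h₂), ω |t - u| = modulusIntegral ω h₁ + modulusIntegral ω h₂ := by
  have hc : Continuous fun u => ω |t - u| := hω.continuous_abs.comp (continuous_const.sub continuous_id)
  rw [← intervalIntegral.integral_add_adjacent_intervals (b := t) (hc.intervalIntegrable _ _)
    (hc.intervalIntegrable _ _), modulusIntegral_eq hh₁, modulusIntegral_eq hh₂]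
  congr 1
  · rw [intervalIntegral.integral_comp_sub_left (fun s => ω |s|) t]
    simp
  · simp_rw [abs_sub_comm t]
    rw [intervalIntegral.integral_comp_sub_right (fun s => ω |s|) t]
    simp

end IsModulusOfContinuity

/-- The substitution `s ↦ (h₁ + h₂) * s` brings the constant to the shape of the right side of
`average_sub_average`. -/
theorem landauK_eq (ω : ℝ → ℝ) {γ₁ γ₂ h₁ h₂ : ℝ} (hh : h₁ + h₂ ≠ 0) :
    landauK ω γ₁ γ₂ h₁ h₂ = ((h₁ - γ₁) + (h₂ - γ₂)) / (h₁ + h₂) *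
      ((∫ s in (0 : ℝ)..(h₁ - γ₁) / ((h₁ - γ₁) + (h₂ - γ₂)), ω ((h₁ + h₂) * s)) +
        ∫ s in (0 : ℝ)..(h₂ - γ₂) / ((h₁ - γ₁) + (h₂ - γ₂)), ω ((h₁ + h₂) * s)) := by
  rw [landauK, modulusIntegral, modulusIntegral, intervalIntegral.integral_comp_mul_left _ hh,
    intervalIntegral.integral_comp_mul_left _ hh, mul_zero, mul_div_assoc, mul_div_assoc,
    smul_eq_mul, smul_eq_mul]
  field_simp

/-! ### Comparison of averages in a normed space -/

section Average

variable {E : Type*} [NormedAddCommGroup E] [NormedSpace ℝ E]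

/-- The difference of the averages over an interval and over an enlarged interval, in terms of the
two reflections with dilation that carry parts of the interval to the added intervals. -/
theorem average_sub_average {G : ℝ → E} (hG : Continuous G) {p q γ L σ₁ σ₂ : ℝ} (hq : q = p + γ)
    (hγ : 0 < γ) (hL : 0 < L) (hσ : σ₁ + σ₂ = 1) :
    γ⁻¹ • (∫ u in p..q, G u) - (γ + L)⁻¹ • (∫ u in (p - L * σ₁)..(q + L * σ₂), G u) =
      (L / (γ + L)) • ((∫ s in (0 : ℝ)..σ₁, (G (p + γ * s) - G (p - L * s))) +
        ∫ s in (0 : ℝ)..σ₂, (G (q - γ * s) - G (q + L * s))) := by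
  have hi : ∀ x y : ℝ, IntervalIntegrable G volume x y := fun x y => hG.intervalIntegrable x y
  have hc : ∀ c d x y : ℝ, IntervalIntegrable (fun s => G (c + d * s)) volume x y := fun c d x y =>
    (hG.comp (by fun_prop)).intervalIntegrable x y
  have hc' : ∀ c d x y : ℝ, IntervalIntegrable (fun s => G (c - d * s)) volume x y :=
    fun c d x y => (hG.comp (by fun_prop)).intervalIntegrable x y
  -- The pieces swept from `p` and from `q` meet at this point, so together they fill the inner
  -- interval exactly once.
  have hm : q - γ * σ₂ = p + γ * σ₁ := by rw [hq, eq_sub_of_add_eq' hσ]; ring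
  rw [intervalIntegral.integral_sub (hc _ _ _ _) (hc' _ _ _ _),
    intervalIntegral.integral_sub (hc' _ _ _ _) (hc _ _ _ _),
    intervalIntegral.integral_comp_add_mul G hγ.ne', intervalIntegral.integral_comp_sub_mul G hL.ne',
    intervalIntegral.integral_comp_sub_mul G hγ.ne', intervalIntegral.integral_comp_add_mul G hL.ne',
    hm]
  simp only [mul_zero, add_zero, sub_zero]
  rw [← intervalIntegral.integral_add_adjacent_intervals (hi p (p + γ * σ₁)) (hi _ q),
    ← intervalIntegral.integral_add_adjacent_intervals (hi (p - L * σ₁) p) (hi _ (q + L * σ₂)),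
    ← intervalIntegral.integral_add_adjacent_intervals (hi p (p + γ * σ₁)) (hi _ (q + L * σ₂)),
    ← intervalIntegral.integral_add_adjacent_intervals (hi (p + γ * σ₁) q) (hi _ (q + L * σ₂))]
  match_scalars <;> field_simp <;> ring

variable {G : ℝ → E} {ω : ℝ → ℝ} {N t h₁ h₂ : ℝ}

theorem norm_integral_sub_le_of_modulus (hω : IsModulusOfContinuity ω) {g₁ g₂ : ℝ → E} {h σ : ℝ}
    (hh : 0 ≤ h) (hσ : 0 ≤ σ)
    (hN : ∀ s ∈ Icc 0 σ, ‖g₁ s - g₂ s‖ ≤ N * ω (h * s)) :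
    ‖∫ s in (0 : ℝ)..σ, (g₁ s - g₂ s)‖ ≤ N * ∫ s in (0 : ℝ)..σ, ω (h * s) := by
  rw [← intervalIntegral.integral_const_mul]
  refine intervalIntegral.norm_integral_le_of_norm_le hσ
    (ae_of_all _ fun s hs => hN s ⟨hs.1.le, hs.2⟩) ?_
  refine ContinuousOn.intervalIntegrable ?_
  refine continuousOn_const.mul (hω.cont.comp (by fun_prop) fun s hs => ?_)
  rw [uIcc_of_le hσ] at hs
  exact mul_nonneg hh hs.1

theorem norm_average_sub_average_le (hω : IsModulusOfContinuity ω) (hG : Continuous G)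
    (hN : ∀ s ∈ Icc (t - h₁) (t + h₂), ∀ u ∈ Icc (t - h₁) (t + h₂),
      ‖G s - G u‖ ≤ N * ω |s - u|)
    {γ₁ γ₂ : ℝ} (hγ : 0 < γ₁ + γ₂) (h1 : γ₁ ≤ h₁) (h2 : γ₂ ≤ h₂) :
    ‖(γ₁ + γ₂)⁻¹ • (∫ u in (t - γ₁)..(t + γ₂), G u) -
      (h₁ + h₂)⁻¹ • ∫ u in (t - h₁)..(t + h₂), G u‖ ≤ landauK ω γ₁ γ₂ h₁ h₂ * N := by
  -- If nothing is added, the proportions `σ₁`, `σ₂` make no sense, but both sides vanish.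
  rcases (show (0 : ℝ) ≤ (h₁ - γ₁) + (h₂ - γ₂) by linarith).eq_or_lt with hL | hL
  · obtain rfl : γ₁ = h₁ := by linarith
    obtain rfl : γ₂ = h₂ := by linarith
    simp [landauK]
  rw [landauK_eq ω (by linarith : h₁ + h₂ ≠ 0)]
  set L := (h₁ - γ₁) + (h₂ - γ₂) with hLdef
  set σ₁ := (h₁ - γ₁) / L with hσ₁
  set σ₂ := (h₂ - γ₂) / L with hσ₂
  have e1 : L * σ₁ = h₁ - γ₁ := mul_div_cancel₀ _ hL.ne'
  have e2 : L * σ₂ = h₂ - γ₂ := mul_div_cancel₀ _ hL.ne'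
  have hσ : σ₁ + σ₂ = 1 := by rw [hσ₁, hσ₂, ← add_div, div_self hL.ne']
  have p1 : 0 ≤ σ₁ := div_nonneg (by linarith) hL.le
  have p2 : 0 ≤ σ₂ := div_nonneg (by linarith) hL.le
  have key := average_sub_average hG (p := t - γ₁) (q := t + γ₂) (by ring) hγ hL hσ
  rw [show t - γ₁ - L * σ₁ = t - h₁ by rw [e1]; ring,
    show t + γ₂ + L * σ₂ = t + h₂ by rw [e2]; ring,
    show γ₁ + γ₂ + L = h₁ + h₂ by rw [hLdef]; ring] at key
  rw [key, norm_smul, Real.norm_of_nonneg (div_nonneg hL.le (by linarith)), mul_assoc]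
  refine mul_le_mul_of_nonneg_left ?_ (div_nonneg hL.le (by linarith))
  rw [add_mul, mul_comm _ N, mul_comm _ N]
  have hh : 0 ≤ h₁ + h₂ := by linarith
  refine (norm_add_le _ _).trans (add_le_add ?_ ?_)
  · refine norm_integral_sub_le_of_modulus hω hh p1 fun s hs => ?_
    have b1 : L * s ≤ h₁ - γ₁ := e1 ▸ mul_le_mul_of_nonneg_left hs.2 hL.le
    have b2 : (γ₁ + γ₂) * s ≤ γ₁ + γ₂ := mul_le_of_le_one_right hγ.le (by linarith [hs.2])
    have b3 := mul_nonneg hγ.le hs.1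
    have b4 := mul_nonneg hL.le hs.1
    refine (hN _ ⟨by linarith, by linarith⟩ _ ⟨by linarith, by linarith⟩).trans_eq ?_
    rw [show t - γ₁ + (γ₁ + γ₂) * s - (t - γ₁ - L * s) = (h₁ + h₂) * s by rw [hLdef]; ring,
      abs_of_nonneg (mul_nonneg hh hs.1)]
  · refine norm_integral_sub_le_of_modulus hω hh p2 fun s hs => ?_
    have b1 : L * s ≤ h₂ - γ₂ := e2 ▸ mul_le_mul_of_nonneg_left hs.2 hL.le
    have b2 : (γ₁ + γ₂) * s ≤ γ₁ + γ₂ := mul_le_of_le_one_right hγ.le (by linarith [hs.2])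
    have b3 := mul_nonneg hγ.le hs.1
    have b4 := mul_nonneg hL.le hs.1
    refine (hN _ ⟨by linarith, by linarith⟩ _ ⟨by linarith, by linarith⟩).trans_eq ?_
    rw [show t + γ₂ - (γ₁ + γ₂) * s - (t + γ₂ + L * s) = -((h₁ + h₂) * s) by rw [hLdef]; ring,
      abs_neg, abs_of_nonneg (mul_nonneg hh hs.1)]

theorem norm_sub_average_le [CompleteSpace E] (hω : IsModulusOfContinuity ω) (hG : Continuous G)
    (hh₁ : 0 ≤ h₁) (hh₂ : 0 ≤ h₂) (hh : 0 < h₁ + h₂)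
    (hN : ∀ u ∈ Icc (t - h₁) (t + h₂), ‖G t - G u‖ ≤ N * ω |t - u|) :
    ‖G t - (h₁ + h₂)⁻¹ • ∫ u in (t - h₁)..(t + h₂), G u‖ ≤
      (modulusIntegral ω h₁ + modulusIntegral ω h₂) / (h₁ + h₂) * N := by
  have e : G t - (h₁ + h₂)⁻¹ • ∫ u in (t - h₁)..(t + h₂), G u =
      (h₁ + h₂)⁻¹ • ∫ u in (t - h₁)..(t + h₂), (G t - G u) := by
    rw [intervalIntegral.integral_sub (by simp) (hG.intervalIntegrable _ _),
      intervalIntegral.integral_const, smul_sub, smul_smul,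
      show t + h₂ - (t - h₁) = h₁ + h₂ by ring, inv_mul_cancel₀ hh.ne', one_smul]
  have hc : Continuous fun u => ω |t - u| :=
    hω.continuous_abs.comp (continuous_const.sub continuous_id)
  rw [e, norm_smul, norm_inv, Real.norm_of_nonneg hh.le, ← hω.integral_abs_sub t hh₁ hh₂,
    inv_mul_eq_div, div_mul_eq_mul_div, mul_comm _ N, ← intervalIntegral.integral_const_mul]
  gcongr
  exact intervalIntegral.norm_integral_le_of_norm_le (by linarith)
    (ae_of_all _ fun s hs => hN s ⟨hs.1.le, hs.2⟩)
    ((continuous_const.mul hc).intervalIntegrable _ _)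

end Average

/-! ### Functions with a density: Hukuhara differences and derivatives -/

section Density

theorem hukuharaDiff_eq {X : Type*} [MetricSpace X] [AddCommMonoid X] [Fact (IsIsotropic X)]
    {x y z : X} (h : x = y + z) : hukuharaDiff x y = z := by
  have hex : HukuharaDiffExists x y := ⟨z, h⟩
  rw [hukuharaDiff, dif_pos hex]
  have h2 : y + hex.choose = y + z := hex.choose_spec.symm.trans h
  rw [← dist_eq_zero, ← (Fact.out : IsIsotropic X) _ _ y, add_comm _ y, add_comm _ y, h2, dist_self]

variable {X : Type*} [MetricSpace X] [AddCommMonoid X] [DistribMulAction ℝ X] [LSpace X]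
  [Fact (IsIsotropic X)] {P : X → X}

/-- On `[a, b]` the function `f` is an indefinite integral of `d`, and `G` is a continuous function
that represents `d` in the envelope of the cone of convex elements. -/
structure HasDensity (a b : ℝ) (f d : ℝ → X) (G : ℝ → Envelope (convexSubmonoid X)) : Prop where
  cont : Continuous G
  rep : ∀ u ∈ Icc a b, EnvelopeRep (d u) (G u)
  exists_add : ∀ u ∈ Icc a b, ∀ v ∈ Icc a b, u ≤ v →
    ∃ z, f v = f u + z ∧ EnvelopeRep z (∫ s in u..v, G s)

namespace HasDensity

variable {a b : ℝ} {f d : ℝ → X} {G : ℝ → Envelope (convexSubmonoid X)} {u v t : ℝ}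

theorem hukuharaDiffExists (h : HasDensity a b f d G) (hu : u ∈ Icc a b) (hv : v ∈ Icc a b)
    (huv : u ≤ v) : HukuharaDiffExists (f v) (f u) :=
  let ⟨z, hz, _⟩ := h.exists_add u hu v hv huv
  ⟨z, hz⟩

theorem envelopeRep_hukuharaDiff (h : HasDensity a b f d G) (hu : u ∈ Icc a b) (hv : v ∈ Icc a b)
    (huv : u ≤ v) : EnvelopeRep (hukuharaDiff (f v) (f u)) (∫ s in u..v, G s) := by
  obtain ⟨z, hz, hr⟩ := h.exists_add u hu v hv huv
  rwa [hukuharaDiff_eq hz]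

theorem envelopeRep_dividedDiff (h : HasDensity a b f d G) {γ₁ γ₂ : ℝ} (hγ : 0 ≤ γ₁ + γ₂)
    (hu : t - γ₁ ∈ Icc a b) (hv : t + γ₂ ∈ Icc a b) :
    EnvelopeRep (hukuharaDividedDiff γ₁ γ₂ f t)
      ((γ₁ + γ₂)⁻¹ • ∫ s in (t - γ₁)..(t + γ₂), G s) :=
  (h.envelopeRep_hukuharaDiff hu hv (by linarith)).smul (inv_nonneg.2 hγ)

/-- This is the fundamental theorem of calculus for `G`; the isometric embedding carries convergence
of the difference quotients back to `X`. -/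
theorem hasHukuharaDerivAt (h : HasDensity a b f d G) (ht : t ∈ Icc a b) :
    HasHukuharaDerivAt a b f t (d t) := by
  have hF : HasDerivAt (fun v => ∫ s in t..v, G s) (G t) t :=
    h.cont.integral_hasStrictDerivAt t t |>.hasDerivAt
  constructor
  · intro htb
    have hev : ∀ᶠ γ in 𝓝[>] (0 : ℝ), 0 ≤ γ ∧ t + γ ∈ Icc a b := by
      filter_upwards [Ioo_mem_nhdsGT (sub_pos.2 htb)] with γ hγ
      exact ⟨hγ.1.le, by linarith [ht.1, hγ.1], by linarith [hγ.2]⟩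
    refine ⟨hev.mono fun γ hγ => h.hukuharaDiffExists ht hγ.2 (by linarith [hγ.1]), ?_⟩
    refine (EnvelopeRep.tendsto_iff (hev.mono fun γ hγ =>
      (h.envelopeRep_hukuharaDiff ht hγ.2 (by linarith [hγ.1])).smul (inv_nonneg.2 hγ.1))
      (h.rep t ht)).2 ?_
    simpa using hF.tendsto_slope_zero_right
  · intro hat
    have hev : ∀ᶠ γ in 𝓝[>] (0 : ℝ), 0 ≤ γ ∧ t - γ ∈ Icc a b := by
      filter_upwards [Ioo_mem_nhdsGT (sub_pos.2 hat)] with γ hγ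
      exact ⟨hγ.1.le, by linarith [hγ.2], by linarith [ht.2, hγ.1]⟩
    refine ⟨hev.mono fun γ hγ => h.hukuharaDiffExists hγ.2 ht (by linarith [hγ.1]), ?_⟩
    refine (EnvelopeRep.tendsto_iff (hev.mono fun γ hγ =>
      (h.envelopeRep_hukuharaDiff hγ.2 ht (by linarith [hγ.1])).smul (inv_nonneg.2 hγ.1))
      (h.rep t ht)).2 ?_
    have hneg : Tendsto (fun γ : ℝ => -γ) (𝓝[>] 0) (𝓝[<] 0) := by
      simpa using tendsto_neg_nhdsGT (a := (0 : ℝ))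
    refine (hF.tendsto_slope_zero_left.comp hneg).congr fun γ => ?_
    simp only [Function.comp_apply, intervalIntegral.integral_same, sub_zero]
    rw [intervalIntegral.integral_symm, ← sub_eq_add_neg, inv_neg, smul_neg, neg_smul, neg_neg]

theorem hukuharaDeriv_eq (h : HasDensity a b f d G) (hab : a < b) (ht : t ∈ Icc a b) :
    hukuharaDeriv a b f t = d t := by
  have hd := h.hasHukuharaDerivAt ht
  have hex : ∃ d, HasHukuharaDerivAt a b f t d := ⟨_, hd⟩
  rw [hukuharaDeriv, dif_pos hex]
  -- At the right endpoint only the left limit is imposed, and `hab` makes it available.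
  rcases ht.2.lt_or_eq with htb | rfl
  · exact tendsto_nhds_unique (hex.choose_spec.1 htb).2 (hd.1 htb).2
  · exact tendsto_nhds_unique (hex.choose_spec.2 hab).2 (hd.2 hab).2

theorem envelopeRep_hukuharaDeriv (h : HasDensity a b f d G) (hab : a < b) (ht : t ∈ Icc a b) :
    EnvelopeRep (hukuharaDeriv a b f t) (G t) := h.hukuharaDeriv_eq hab ht ▸ h.rep t ht

theorem dist_hukuharaDeriv (h : HasDensity a b f d G) (hab : a < b) (hu : u ∈ Icc a b)
    (hv : v ∈ Icc a b) :
    dist (hukuharaDeriv a b f u) (hukuharaDeriv a b f v) = ‖G u - G v‖ := by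
  rw [(h.envelopeRep_hukuharaDeriv hab hu).dist_eq (h.envelopeRep_hukuharaDeriv hab hv),
    dist_eq_norm]

theorem mem_upperBounds_omegaRatios (h : HasDensity a b f d G) (hab : a < b) {ω : ℝ → ℝ}
    (hpos : ∀ s, 0 < s → 0 < ω s) {k : ℝ}
    (hk : ∀ s ∈ Icc a b, ∀ u ∈ Icc a b, ‖G s - G u‖ ≤ k * ω |s - u|) :
    k ∈ upperBounds (omegaRatios ω a b (hukuharaDeriv a b f)) := by
  rintro r ⟨s, hs, u, hu, hsu, rfl⟩
  rw [h.dist_hukuharaDeriv hab hs hu, div_le_iff₀ (hpos _ (abs_pos.2 (sub_ne_zero.2 hsu)))]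
  exact hk s hs u hu

theorem norm_sub_le_omegaNorm (h : HasDensity a b f d G) (hab : a < b) {ω : ℝ → ℝ}
    (hω : IsModulusOfContinuity ω) (hpos : ∀ s, 0 < s → 0 < ω s)
    (hbdd : BddAbove (omegaRatios ω a b (hukuharaDeriv a b f)))
    (hu : u ∈ Icc a b) (hv : v ∈ Icc a b) :
    ‖G u - G v‖ ≤ omegaNorm ω a b (hukuharaDeriv a b f) * ω |u - v| := by
  rcases eq_or_ne u v with rfl | huv
  · simp [hω.zero]
  rw [← div_le_iff₀ (hpos _ (abs_pos.2 (sub_ne_zero.2 huv))), ← h.dist_hukuharaDeriv hab hu hv]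
  exact le_csSup hbdd ⟨u, hu, v, hv, huv, rfl⟩

end HasDensity

theorem IsConvexifying.hasDensity (hP : IsConvexifying P) {a b k : ℝ} (hk : 0 ≤ k) {x : X}
    {f φ : ℝ → X} (hφ : ContinuousOn φ (Icc a b))
    {G : ℝ → Envelope (convexSubmonoid X)} (hG : Continuous G)
    (hGφ : ∀ u ∈ Icc a b, G u = k • hP.toEnvelope (φ u))
    (hf : ∀ u ∈ Icc a b, f u = k • (x + lSpaceIntegral P φ a u)) :
    HasDensity a b f (fun u => k • P (φ u)) G where
  cont := hG
  rep u hu := hGφ u hu ▸ (hP.envelopeRep (φ u)).smul hk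
  exists_add u hu v hv huv := by
    have hsub : ∀ {c d : ℝ}, a ≤ c → d ≤ b → ContinuousOn φ (Icc c d) := fun hc hd =>
      hφ.mono (Icc_subset_Icc hc hd)
    have hint : ∀ {c d : ℝ}, a ≤ c → c ≤ d → d ≤ b →
        IntervalIntegrable (fun s => hP.toEnvelope (φ s)) volume c d := fun hc hcd hd =>
      (hP.continuous_toEnvelope.comp_continuousOn (hsub hc hd)).intervalIntegrable_of_Icc hcd
    have hr := hP.envelopeRep_lSpaceIntegral huv (hsub hu.1 hv.2)
    refine ⟨k • lSpaceIntegral P φ u v, ?_, ?_⟩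
    · have hu' := hP.envelopeRep_lSpaceIntegral hu.1 (hsub le_rfl hu.2)
      have hv' := hP.envelopeRep_lSpaceIntegral hv.1 (hsub le_rfl hv.2)
      rw [← intervalIntegral.integral_add_adjacent_intervals (hint le_rfl hu.1 hu.2)
        (hint hu.1 huv hv.2)] at hv'
      rw [hf u hu, hf v hv, hv'.eq (hu'.add hr), smul_add, smul_add, smul_add, add_assoc]
    · have : ∫ s in u..v, G s = k • ∫ s in u..v, hP.toEnvelope (φ s) := by
        rw [← intervalIntegral.integral_smul]
        refine intervalIntegral.integral_congr fun s hs => ?_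
        rw [uIcc_of_le huv] at hs
        exact hGφ s ⟨hu.1.trans hs.1, hs.2.trans hv.2⟩
      rw [this]
      exact hr.smul hk

theorem continuousOn_of_mem_HClass {ω : ℝ → ℝ} (hω : IsModulusOfContinuity ω) {a b : ℝ}
    {X : Type*} [MetricSpace X] {φ : ℝ → X} (hφ : φ ∈ HClass ω a b X) :
    ContinuousOn φ (Icc a b) := by
  intro u hu
  rw [ContinuousWithinAt, tendsto_iff_dist_tendsto_zero]
  have h0 : Tendsto (fun s => ω |s - u|) (𝓝[Icc a b] u) (𝓝 0) := by
    have : Continuous fun s => ω |s - u| := hω.continuous_abs.comp (continuous_id.sub continuous_const)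
    simpa [hω.zero] using (this.tendsto u).mono_left nhdsWithin_le_nhds
  refine squeeze_zero' (Eventually.of_forall fun _ => dist_nonneg) ?_ h0
  filter_upwards [self_mem_nhdsWithin] with s hs using hφ s hs u hu

theorem exists_hasDensity_of_mem_W1HBarClass (hP : IsConvexifying P) {ω : ℝ → ℝ}
    (hω : IsModulusOfContinuity ω) {a b : ℝ} (hab : a ≤ b) {f : ℝ → X}
    (hf : f ∈ W1HBarClass P ω a b) :
    ∃ (k : ℝ) (d : ℝ → X) (G : ℝ → Envelope (convexSubmonoid X)), HasDensity a b f d G ∧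
      ∀ s ∈ Icc a b, ∀ u ∈ Icc a b, ‖G s - G u‖ ≤ k * ω |s - u| := by
  obtain ⟨k, hk, g, ⟨x, -, φ, hφ, hg⟩, hf⟩ := hf
  have hc := continuousOn_of_mem_HClass hω hφ
  -- Extending by the endpoint values makes `G` continuous on the whole line, as `HasDensity`
  -- demands.
  have hGφ : ∀ u ∈ Icc a b, IccExtend hab
      (fun u : Icc a b => k • hP.toEnvelope (φ u)) u = k • hP.toEnvelope (φ u) := fun u hu => by
    rw [IccExtend_of_mem hab _ hu]
  refine ⟨k, fun u => k • P (φ u), _, hP.hasDensity hk.le hc (x := x) ?_ hGφ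
    fun u hu => by rw [hf u hu, hg u hu], fun s hs u hu => ?_⟩
  · refine Continuous.Icc_extend' ?_
    exact (hP.continuous_toEnvelope.comp (continuousOn_iff_continuous_domRestrict.1 hc)).const_smul k
  · rw [hGφ s hs, hGφ u hu, ← smul_sub, norm_smul, Real.norm_of_nonneg hk.le, ← dist_eq_norm]
    exact mul_le_mul_of_nonneg_left ((hP.dist_toEnvelope_le _ _).trans (hφ s hs u hu)) hk.le

end Density

/-! ### Extremal functions -/

section Extremal

variable {ω : ℝ → ℝ}

theorem continuous_of_abs_sub_le (hω : IsModulusOfContinuity ω) {ψ : ℝ → ℝ}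
    (hψ : ∀ s u, |ψ s - ψ u| ≤ ω |s - u|) : Continuous ψ := by
  rw [continuous_iff_continuousAt]
  intro u
  have hmem : ψ ∈ HClass ω (u - 1) (u + 1) ℝ := fun s _ v _ => hψ s v
  exact (continuousOn_of_mem_HClass hω hmem).continuousAt
    (Icc_mem_nhds (by linarith) (by linarith))

/-- A ray of the cone is a copy of `[0, ∞)`. With density `(C + ψ) • y` for a unit vector `y`, all
norms become scalar quantities without absolute values. The condition `hext` forces the norm to be
exactly `1`. -/
theorem exists_mem_W1HClass_of_scalar {X : Type*} [MetricSpace X] [AddCommMonoid X]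
    [DistribMulAction ℝ X] [LSpace X] [Fact (IsIsotropic X)] {P : X → X}
    (hP : IsConvexifying P) (hω : IsModulusOfContinuity ω) (hpos : ∀ s, 0 < s → 0 < ω s)
    {a b : ℝ} (hab : a < b) (hX : ∃ x ∈ convexElements X, x ≠ 0) {ψ : ℝ → ℝ}
    (hψ : ∀ s u, |ψ s - ψ u| ≤ ω |s - u|)
    (hext : ∃ s ∈ Icc a b, ∃ u ∈ Icc a b, s ≠ u ∧ |ψ s - ψ u| = ω |s - u|) :
    ∃ f ∈ W1HClass P ω a b, ∃ C : ℝ, omegaNorm ω a b (hukuharaDeriv a b f) = 1 ∧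
      (∀ u ∈ Icc a b, dist (hukuharaDeriv a b f u) 0 = C + ψ u) ∧
      ∀ t γ₁ γ₂ : ℝ, 0 < γ₁ + γ₂ → t - γ₁ ∈ Icc a b → t + γ₂ ∈ Icc a b →
        dist (hukuharaDividedDiff γ₁ γ₂ f t) 0 =
          C + (γ₁ + γ₂)⁻¹ * ∫ u in (t - γ₁)..(t + γ₂), ψ u := by
  obtain ⟨x, hx, hx0⟩ := hX
  have hcont := continuous_of_abs_sub_le hω hψ
  -- The constant `C = -m` lifts `ψ` to non-negative values on `[a, b]`, so that the multiples of
  -- `y` stay on its ray in the cone.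
  obtain ⟨m, hm⟩ := (isCompact_Icc (a := a) (b := b)).bddBelow_image hcont.continuousOn
  have hC : ∀ u ∈ Icc a b, 0 ≤ -m + ψ u := fun u hu => by
    linarith [hm (mem_image_of_mem ψ hu)]
  set C := -m
  have hr : EnvelopeRep x (hP.toEnvelope x) := by
    have := hP.envelopeRep x
    rwa [hP.apply_of_mem hx] at this
  have hn : 0 < ‖hP.toEnvelope x‖ := by
    rw [← hr.dist_zero]; exact dist_pos.2 hx0
  set e := ‖hP.toEnvelope x‖⁻¹ • hP.toEnvelope x with he
  have hre : EnvelopeRep (‖hP.toEnvelope x‖⁻¹ • x) e := hr.smul (inv_nonneg.2 hn.le)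
  have hne : ‖e‖ = 1 := by
    rw [he, norm_smul, norm_inv, norm_norm, inv_mul_cancel₀ hn.ne']
  set y := ‖hP.toEnvelope x‖⁻¹ • x
  let φ : ℝ → X := fun u => (C + ψ u) • y
  let G : ℝ → Envelope (convexSubmonoid X) := fun u => (C + ψ u) • e
  have hrep : ∀ u ∈ Icc a b, EnvelopeRep (φ u) (G u) := fun u hu => hre.smul (hC u hu)
  have hGsub : ∀ s u, ‖G s - G u‖ = |ψ s - ψ u| := fun s u => by
    rw [← sub_smul, norm_smul, hne, mul_one, add_sub_add_left_eq_sub, Real.norm_eq_abs]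
  have hφ : φ ∈ HClass ω a b X := fun s hs u hu => by
    rw [(hrep s hs).dist_eq (hrep u hu), dist_eq_norm, hGsub]
    exact hψ s u
  have hG : Continuous G := (continuous_const.add hcont).smul continuous_const
  have hGφ : ∀ u ∈ Icc a b, G u = (1 : ℝ) • hP.toEnvelope (φ u) := fun u hu => by
    obtain ⟨hmem, h⟩ := hrep u hu
    rw [one_smul, ← h, IsConvexifying.toEnvelope]
    congr 1
    exact Subtype.ext (hP.apply_of_mem hmem).symm
  have hd : HasDensity a b (fun u => lSpaceIntegral P φ a u) (fun u => (1 : ℝ) • P (φ u)) G :=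
    hP.hasDensity zero_le_one (x := 0) (continuousOn_of_mem_HClass hω hφ) hG hGφ
      fun u _ => by rw [zero_add, one_smul]
  have hub := hd.mem_upperBounds_omegaRatios hab (ω := ω) hpos (k := 1) fun s _ u _ => by
    rw [hGsub, one_mul]; exact hψ s u
  refine ⟨_, ⟨0, zero_mem_convexElements, φ, hφ, fun u _ => (zero_add _).symm⟩, C, ?_, ?_, ?_⟩
  · obtain ⟨s, hs, u, hu, hsu, h⟩ := hext
    have h1 : (1 : ℝ) ∈ omegaRatios ω a b (hukuharaDeriv a b fun u => lSpaceIntegral P φ a u) := by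
      refine ⟨s, hs, u, hu, hsu, ?_⟩
      rw [hd.dist_hukuharaDeriv hab hs hu, hGsub, h,
        div_self (hpos _ (abs_pos.2 (sub_ne_zero.2 hsu))).ne']
    exact le_antisymm (csSup_le ⟨1, h1⟩ hub) (le_csSup ⟨1, hub⟩ h1)
  · intro u hu
    rw [(hd.envelopeRep_hukuharaDeriv hab hu).dist_zero, norm_smul, hne, mul_one,
      Real.norm_of_nonneg (hC u hu)]
  · intro t γ₁ γ₂ hγ hu hv
    have hle : t - γ₁ ≤ t + γ₂ := by linarith
    have h0 : 0 ≤ ∫ u in (t - γ₁)..(t + γ₂), (C + ψ u) :=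
      intervalIntegral.integral_nonneg hle fun u h => hC u ⟨hu.1.trans h.1, h.2.trans hv.2⟩
    rw [(hd.envelopeRep_dividedDiff hγ.le hu hv).dist_zero, intervalIntegral.integral_smul_const,
      norm_smul, norm_smul, hne, mul_one, Real.norm_of_nonneg h0, norm_inv,
      Real.norm_of_nonneg hγ.le, intervalIntegral.integral_add (by simp)
      (hcont.intervalIntegrable _ _), intervalIntegral.integral_const, smul_eq_mul]
    field_simp
    ring

/-- The function that glues two rescaled copies of a modulus of continuity, with
dilations `1 / w₁` to the right and `1 / w₂` to the left of `0`. -/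
noncomputable def extremalProfile (ω : ℝ → ℝ) (w₁ w₂ y : ℝ) : ℝ :=
  w₁ * ω (max y 0 / w₁) - w₂ * ω (max (-y) 0 / w₂)

variable {w₁ w₂ : ℝ}

theorem extremalProfile_of_nonneg (hω : IsModulusOfContinuity ω) {y : ℝ} (hy : 0 ≤ y) :
    extremalProfile ω w₁ w₂ y = w₁ * ω (y / w₁) := by
  rw [extremalProfile, max_eq_left hy, max_eq_right (neg_nonpos.2 hy), zero_div, hω.zero, mul_zero,
    sub_zero]

theorem extremalProfile_of_nonpos (hω : IsModulusOfContinuity ω) {y : ℝ} (hy : y ≤ 0) :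
    extremalProfile ω w₁ w₂ y = -(w₂ * ω (-y / w₂)) := by
  rw [extremalProfile, max_eq_right hy, max_eq_left (neg_nonneg.2 hy), zero_div, hω.zero, mul_zero,
    zero_sub]

theorem monotone_extremalProfile (hω : IsModulusOfContinuity ω) (h₁ : 0 < w₁) (h₂ : 0 < w₂) :
    Monotone (extremalProfile ω w₁ w₂) := fun x y hxy => by
  unfold extremalProfile
  refine sub_le_sub (mul_le_mul_of_nonneg_left (hω.mono ?_ ?_ ?_) h₁.le)
    (mul_le_mul_of_nonneg_left (hω.mono ?_ ?_ ?_) h₂.le)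
  any_goals exact mem_Ici.2 (by positivity)
  · gcongr
  · gcongr

theorem mul_apply_div_le_of_concaveOn (hω : IsModulusOfContinuity ω)
    (hc : ConcaveOn ℝ (Ici 0) ω) {w y : ℝ} (hw : 0 < w) (hw1 : w ≤ 1) (hy : 0 ≤ y) :
    w * ω (y / w) ≤ ω y := by
  have := hc.2 (mem_Ici.2 (div_nonneg hy hw.le)) self_mem_Ici hw.le (sub_nonneg.2 hw1)
    (add_sub_cancel _ _)
  simpa [hω.zero, mul_div_cancel₀ y hw.ne'] using this

/-- On one side of `0`, semi-additivity together with `w * ω (y / w) ≤ ω y` suffices. Across `0`,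
the increment is a convex combination of values of `ω`, and Jensen's inequality bounds it. -/
theorem abs_extremalProfile_sub_le (hω : IsModulusOfContinuity ω) (hc : ConcaveOn ℝ (Ici 0) ω)
    (h₁ : 0 < w₁) (h₂ : 0 < w₂) (hw : w₁ + w₂ = 1) (x y : ℝ) :
    |extremalProfile ω w₁ w₂ x - extremalProfile ω w₁ w₂ y| ≤ ω |x - y| := by
  wlog hyx : y ≤ x generalizing x y
  · rw [abs_sub_comm, abs_sub_comm x]
    exact this y x (le_of_not_ge hyx)
  rw [abs_of_nonneg (sub_nonneg.2 (monotone_extremalProfile hω h₁ h₂ hyx)),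
    abs_of_nonneg (sub_nonneg.2 hyx)]
  have key : ∀ {w p r : ℝ}, 0 < w → w ≤ 1 → 0 ≤ p → p ≤ r →
      w * ω (r / w) - w * ω (p / w) ≤ ω (r - p) := fun {w p r} h0 h1 hp hpr => by
    have h3 := hω.subadd (p / w) ((r - p) / w) (div_nonneg hp h0.le)
      (div_nonneg (sub_nonneg.2 hpr) h0.le)
    rw [← add_div, add_sub_cancel] at h3
    have h4 := mul_apply_div_le_of_concaveOn hω hc h0 h1 (sub_nonneg.2 hpr)
    have h5 := mul_le_mul_of_nonneg_left h3 h0.le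
    linarith
  rcases le_total 0 y with hy | hy
  · rw [extremalProfile_of_nonneg hω hy, extremalProfile_of_nonneg hω (hy.trans hyx)]
    exact key h₁ (by linarith) hy hyx
  rcases le_total 0 x with hx | hx
  · rw [extremalProfile_of_nonneg hω hx, extremalProfile_of_nonpos hω hy]
    -- The weights cancel the dilations: the convex combination of `x / w₁` and `-y / w₂` is `x -
    -- y`.
    have := hc.2 (mem_Ici.2 (div_nonneg hx h₁.le))
      (mem_Ici.2 (div_nonneg (neg_nonneg.2 hy) h₂.le)) h₁.le h₂.le hw
    simp only [smul_eq_mul, mul_div_cancel₀ _ h₁.ne', mul_div_cancel₀ _ h₂.ne'] at this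
    rwa [sub_neg_eq_add, sub_eq_add_neg]
  · rw [extremalProfile_of_nonpos hω hx, extremalProfile_of_nonpos hω hy]
    have := key h₂ (by linarith) (neg_nonneg.2 hx) (neg_le_neg hyx)
    rw [show -y - -x = x - y by ring] at this
    linarith

/-- With weights proportional to `γ` and `L`, both branches see the same argument `(γ + L) * s`, and
the weights add up to `1`. The profile thus attains the modulus on every pair used in
`average_sub_average`. -/
theorem extremalProfile_sub (hω : IsModulusOfContinuity ω) {γ L s : ℝ} (hγ : 0 < γ) (hL : 0 < L)
    (hs : 0 ≤ s) :
    extremalProfile ω (γ / (γ + L)) (L / (γ + L)) (γ * s) -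
      extremalProfile ω (γ / (γ + L)) (L / (γ + L)) (-(L * s)) = ω ((γ + L) * s) := by
  rw [extremalProfile_of_nonneg hω (by positivity),
    extremalProfile_of_nonpos hω (by simpa using by positivity), neg_neg,
    show γ * s / (γ / (γ + L)) = (γ + L) * s by field_simp,
    show L * s / (L / (γ + L)) = (γ + L) * s by field_simp]
  field_simp
  ring

theorem exists_extremal_scalar (hω : IsModulusOfContinuity ω) (hc : ConcaveOn ℝ (Ici 0) ω)
    {t γ₁ γ₂ h₁ h₂ : ℝ} (hγ : 0 < γ₁ + γ₂) (h1 : γ₁ ≤ h₁)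
    (h2 : γ₂ ≤ h₂) (hL : 0 < (h₁ - γ₁) + (h₂ - γ₂)) :
    ∃ ψ : ℝ → ℝ, (∀ s u, |ψ s - ψ u| ≤ ω |s - u|) ∧
      (∃ s ∈ Icc (t - h₁) (t + h₂), ∃ u ∈ Icc (t - h₁) (t + h₂),
        s ≠ u ∧ |ψ s - ψ u| = ω |s - u|) ∧
      (γ₁ + γ₂)⁻¹ * (∫ u in (t - γ₁)..(t + γ₂), ψ u) -
        (h₁ + h₂)⁻¹ * (∫ u in (t - h₁)..(t + h₂), ψ u) = landauK ω γ₁ γ₂ h₁ h₂ := by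
  have hh : 0 < h₁ + h₂ := by linarith
  rw [landauK_eq ω hh.ne']
  set γ := γ₁ + γ₂ with hγdef
  set L := (h₁ - γ₁) + (h₂ - γ₂) with hLdef
  have hγL : γ + L = h₁ + h₂ := by rw [hLdef, hγdef]; ring
  set σ₁ := (h₁ - γ₁) / L with hσ₁
  set σ₂ := (h₂ - γ₂) / L with hσ₂
  have e1 : L * σ₁ = h₁ - γ₁ := mul_div_cancel₀ _ hL.ne'
  have e2 : L * σ₂ = h₂ - γ₂ := mul_div_cancel₀ _ hL.ne'
  have hσ : σ₁ + σ₂ = 1 := by rw [hσ₁, hσ₂, ← add_div, div_self hL.ne']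
  have p1 : 0 ≤ σ₁ := div_nonneg (by linarith) hL.le
  have p2 : 0 ≤ σ₂ := div_nonneg (by linarith) hL.le
  let Ψ := extremalProfile ω (γ / (γ + L)) (L / (γ + L))
  have hΨ : ∀ x y, |Ψ x - Ψ y| ≤ ω |x - y| := abs_extremalProfile_sub_le hω hc
    (by positivity) (by positivity) (by rw [← add_div, div_self (by positivity)])
  have hmono : Monotone Ψ := monotone_extremalProfile hω (by positivity) (by positivity)
  set p := t - γ₁ with hp
  set q := t + γ₂ with hq
  have hqp : q = p + γ := by rw [hq, hp, hγdef]; ring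
  have hcq : q - γ * σ₂ = p + γ * σ₁ := by rw [hqp, eq_sub_of_add_eq' hσ]; ring
  let A := Ψ (γ * σ₁)
  let B := Ψ (γ * σ₂)
  -- The left term is increasing and the right one decreasing; subtracting `A` and `B` makes both
  -- vanish at the meeting point `p + γ * σ₁`. The minimum therefore follows the profile about `p`
  -- to the left of it and the reflected profile about `q` to the right, and it keeps the modulus.
  let ψ : ℝ → ℝ := fun x => min (Ψ (x - p) - A) (Ψ (q - x) - B)
  have hψ : ∀ s u, |ψ s - ψ u| ≤ ω |s - u| := fun s u => by
    refine (abs_min_sub_min_le_max _ _ _ _).trans (max_le ?_ ?_)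
    · simpa using hΨ (s - p) (u - p)
    · have := hΨ (q - s) (q - u)
      rw [sub_sub_sub_cancel_left, abs_sub_comm u s] at this
      simpa using this
  have hψl : ∀ x, x ≤ p + γ * σ₁ → ψ x = Ψ (x - p) - A := fun x hx => by
    refine min_eq_left ?_
    have i1 : Ψ (x - p) ≤ A := hmono (by linarith)
    have i2 : B ≤ Ψ (q - x) := hmono (by linarith)
    linarith
  have hψr : ∀ x, p + γ * σ₁ ≤ x → ψ x = Ψ (q - x) - B := fun x hx => by
    refine min_eq_right ?_
    have i1 : A ≤ Ψ (x - p) := hmono (by linarith)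
    have i2 : Ψ (q - x) ≤ B := hmono (by linarith)
    linarith
  have hl : ∀ s ∈ Icc 0 σ₁, ψ (p + γ * s) - ψ (p - L * s) = ω ((h₁ + h₂) * s) := fun s hs => by
    have b1 : γ * s ≤ γ * σ₁ := mul_le_mul_of_nonneg_left hs.2 hγ.le
    have b2 := mul_nonneg hγ.le hs.1
    have b3 := mul_nonneg hL.le hs.1
    rw [hψl _ (by linarith), hψl _ (by linarith), ← hγL, ← extremalProfile_sub hω hγ hL hs.1,
      sub_sub_sub_cancel_right, add_sub_cancel_left, sub_sub_cancel_left]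
  have hr : ∀ s ∈ Icc 0 σ₂, ψ (q - γ * s) - ψ (q + L * s) = ω ((h₁ + h₂) * s) := fun s hs => by
    have b1 : γ * s ≤ γ * σ₂ := mul_le_mul_of_nonneg_left hs.2 hγ.le
    have b2 := mul_nonneg hγ.le hs.1
    have b3 := mul_nonneg hL.le hs.1
    rw [hψr _ (by linarith), hψr _ (by linarith), ← hγL, ← extremalProfile_sub hω hγ hL hs.1,
      sub_sub_sub_cancel_right, sub_sub_cancel, sub_add_cancel_left]
  have q1 : p - L * σ₁ = t - h₁ := by rw [e1, hp]; ring
  have q2 : q + L * σ₂ = t + h₂ := by rw [e2, hq]; ring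
  have r1 := mul_nonneg hγ.le p1
  have r2 := mul_nonneg hγ.le p2
  refine ⟨ψ, hψ, ?_, ?_⟩
  · rcases p1.eq_or_lt with h0 | h0
    · have h3 : σ₂ = 1 := by linarith
      refine ⟨q - γ * σ₂, ⟨by linarith, by linarith⟩, q + L * σ₂,
        ⟨by rw [q2]; linarith, q2.le⟩, ?_, ?_⟩
      · rw [h3]; intro h; linarith
      · have hpos : 0 ≤ (h₁ + h₂) * σ₂ := by positivity
        rw [hr σ₂ ⟨p2, le_rfl⟩, abs_of_nonneg (hω.nonneg hpos), ← hγL,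
          show q - γ * σ₂ - (q + L * σ₂) = -((γ + L) * σ₂) by ring, abs_neg, hγL,
          abs_of_nonneg hpos]
    · have hpos : 0 < (h₁ + h₂) * σ₁ := by positivity
      have hd : p + γ * σ₁ - (p - L * σ₁) = (h₁ + h₂) * σ₁ := by rw [← hγL]; ring
      refine ⟨p + γ * σ₁, ⟨by linarith, by linarith⟩, p - L * σ₁,
        ⟨q1.ge, by rw [q1]; linarith⟩, ?_, ?_⟩
      · intro h; linarith
      · rw [hl σ₁ ⟨p1, le_rfl⟩, abs_of_nonneg (hω.nonneg hpos.le), hd, abs_of_nonneg hpos.le]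
  · have key := average_sub_average (continuous_of_abs_sub_le hω hψ) hqp hγ hL hσ
    rw [q1, q2, hγL] at key
    simp only [smul_eq_mul] at key
    rw [key]
    congr 2
    · refine intervalIntegral.integral_congr fun s hs => ?_
      rw [uIcc_of_le p1] at hs
      exact hl s hs
    · refine intervalIntegral.integral_congr fun s hs => ?_
      rw [uIcc_of_le p2] at hs
      exact hr s hs

end Extremal

/-! ### The inequalities and their sharpness -/

theorem mainTheorem9 {X : Type*} [MetricSpace X] [AddCommMonoid X] [DistribMulAction ℝ X]
    [LSpace X] (hX : IsIsotropic X) (P : X → X) (hP : IsConvexifying P)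
    (ω : ℝ → ℝ) (hω : IsModulusOfContinuity ω) (hω0 : ∃ s : ℝ, 0 ≤ s ∧ ω s ≠ 0)
    (a b t h₁ h₂ : ℝ) (hh₁ : 0 ≤ h₁) (hh₂ : 0 ≤ h₂) (hh : 0 < h₁ + h₂)
    (hsub : Icc (t - h₁) (t + h₂) ⊆ Icc a b) :
    -- the objects in the inequalities are well defined
    (∀ f ∈ W1HBarClass P ω a b,
      (∀ u ∈ Icc a b, HasHukuharaDerivAt a b f u (hukuharaDeriv a b f u)) ∧
      BddAbove (omegaRatios ω a b (hukuharaDeriv a b f)) ∧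
      ∀ u ∈ Icc a b, ∀ v ∈ Icc a b, u ≤ v → HukuharaDiffExists (f v) (f u)) ∧
    -- the inequality for divided differences
    (∀ f ∈ W1HBarClass P ω a b, ∀ γ₁ γ₂ : ℝ, 0 ≤ γ₁ → 0 ≤ γ₂ → 0 < γ₁ + γ₂ →
      Icc (t - γ₁) (t + γ₂) ⊆ Icc (t - h₁) (t + h₂) →
      dist (hukuharaDividedDiff γ₁ γ₂ f t) 0 ≤
        landauK ω γ₁ γ₂ h₁ h₂ * omegaNorm ω a b (hukuharaDeriv a b f) +
          dist (hukuharaDividedDiff h₁ h₂ f t) 0) ∧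
    -- the inequality for the derivative
    (∀ f ∈ W1HBarClass P ω a b,
      dist (hukuharaDeriv a b f t) 0 ≤
        (modulusIntegral ω h₁ + modulusIntegral ω h₂) / (h₁ + h₂) *
            omegaNorm ω a b (hukuharaDeriv a b f) +
          dist (hukuharaDividedDiff h₁ h₂ f t) 0) ∧
    -- sharpness of the first inequality, for concave moduli of continuity
    ((∃ x ∈ convexElements X, x ≠ 0) → ConcaveOn ℝ (Ici 0) ω →
      ∀ γ₁ γ₂ : ℝ, 0 ≤ γ₁ → 0 ≤ γ₂ → 0 < γ₁ + γ₂ →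
      Icc (t - γ₁) (t + γ₂) ⊆ Icc (t - h₁) (t + h₂) →
      ∃ f ∈ W1HClass P ω a b, omegaNorm ω a b (hukuharaDeriv a b f) = 1 ∧
        dist (hukuharaDividedDiff γ₁ γ₂ f t) 0 =
          landauK ω γ₁ γ₂ h₁ h₂ * omegaNorm ω a b (hukuharaDeriv a b f) +
            dist (hukuharaDividedDiff h₁ h₂ f t) 0) ∧
    -- sharpness of the second inequality, for arbitrary moduli of continuity
    ((∃ x ∈ convexElements X, x ≠ 0) →
      ∃ f ∈ W1HClass P ω a b, omegaNorm ω a b (hukuharaDeriv a b f) = 1 ∧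
        dist (hukuharaDeriv a b f t) 0 =
          (modulusIntegral ω h₁ + modulusIntegral ω h₂) / (h₁ + h₂) *
              omegaNorm ω a b (hukuharaDeriv a b f) +
            dist (hukuharaDividedDiff h₁ h₂ f t) 0) := by
  have := Fact.mk hX
  have hpos : ∀ s, 0 < s → 0 < ω s := fun s hs => hω.pos hω0 hs
  have hle : t - h₁ ≤ t + h₂ := by linarith
  have ha : a ≤ t - h₁ := (hsub (left_mem_Icc.2 hle)).1
  have hb : t + h₂ ≤ b := (hsub (right_mem_Icc.2 hle)).2
  have hab : a < b := by linarith
  have ht : t ∈ Icc a b := ⟨by linarith, by linarith⟩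
  have hm₁ : t - h₁ ∈ Icc a b := hsub (left_mem_Icc.2 hle)
  have hm₂ : t + h₂ ∈ Icc a b := hsub (right_mem_Icc.2 hle)
  have hbounds : ∀ γ₁ γ₂ : ℝ, 0 < γ₁ + γ₂ →
      Icc (t - γ₁) (t + γ₂) ⊆ Icc (t - h₁) (t + h₂) → γ₁ ≤ h₁ ∧ γ₂ ≤ h₂ := fun γ₁ γ₂ hγ h => by
    have hγ' : t - γ₁ ≤ t + γ₂ := by linarith
    have i1 := (h (left_mem_Icc.2 hγ')).1
    have i2 := (h (right_mem_Icc.2 hγ')).2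
    exact ⟨by linarith, by linarith⟩
  have hderiv : (∃ x ∈ convexElements X, x ≠ 0) →
      ∃ f ∈ W1HClass P ω a b, omegaNorm ω a b (hukuharaDeriv a b f) = 1 ∧
        dist (hukuharaDeriv a b f t) 0 =
          (modulusIntegral ω h₁ + modulusIntegral ω h₂) / (h₁ + h₂) *
              omegaNorm ω a b (hukuharaDeriv a b f) +
            dist (hukuharaDividedDiff h₁ h₂ f t) 0 := fun hx => by
    -- The scalar extremal for (2) peaks at `t` and falls off exactly like `ω`.
    have hψ : ∀ s u, |-ω (|t - s|) - -ω (|t - u|)| ≤ ω |s - u| := fun s u => by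
      rw [neg_sub_neg]
      refine (hω.abs_sub_abs_le _ _).trans_eq ?_
      rw [sub_sub_sub_cancel_left]
    have hext : ∃ s ∈ Icc a b, ∃ u ∈ Icc a b, s ≠ u ∧
        |-ω (|t - s|) - -ω (|t - u|)| = ω |s - u| := by
      obtain ⟨u, hu, htu⟩ : ∃ u ∈ Icc a b, t ≠ u := by
        by_contra! h
        linarith [h a (left_mem_Icc.2 hab.le), h b (right_mem_Icc.2 hab.le)]
      refine ⟨t, ht, u, hu, htu, ?_⟩
      rw [sub_self, abs_zero, hω.zero, neg_zero, zero_sub, neg_neg,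
        abs_of_nonneg (hω.nonneg (abs_nonneg _))]
    obtain ⟨f, hf, C, hn, hd, hdd⟩ := exists_mem_W1HClass_of_scalar hP hω hpos hab hx hψ hext
    refine ⟨f, hf, hn, ?_⟩
    rw [hn, hd t ht, hdd t h₁ h₂ hh hm₁ hm₂, intervalIntegral.integral_neg,
      hω.integral_abs_sub t hh₁ hh₂, sub_self, abs_zero, hω.zero]
    field_simp
    ring
  refine ⟨fun f hf => ?_, fun f hf γ₁ γ₂ hγ₁ hγ₂ hγ hγsub => ?_, fun f hf => ?_,
    fun hx hc γ₁ γ₂ hγ₁ hγ₂ hγ hγsub => ?_, hderiv⟩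
  · obtain ⟨k, d, G, hd, hk⟩ := exists_hasDensity_of_mem_W1HBarClass hP hω hab.le hf
    exact ⟨fun u hu => hd.hukuharaDeriv_eq hab hu ▸ hd.hasHukuharaDerivAt hu,
      ⟨k, hd.mem_upperBounds_omegaRatios hab hpos hk⟩, fun u hu v hv => hd.hukuharaDiffExists hu hv⟩
  · obtain ⟨k, d, G, hd, hk⟩ := exists_hasDensity_of_mem_W1HBarClass hP hω hab.le hf
    have hbdd : BddAbove (omegaRatios ω a b (hukuharaDeriv a b f)) :=
      ⟨k, hd.mem_upperBounds_omegaRatios hab hpos hk⟩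
    obtain ⟨i1, i2⟩ := hbounds γ₁ γ₂ hγ hγsub
    rw [(hd.envelopeRep_dividedDiff hγ.le ⟨by linarith, by linarith⟩
        ⟨by linarith, by linarith⟩).dist_zero,
      (hd.envelopeRep_dividedDiff hh.le hm₁ hm₂).dist_zero, ← sub_le_iff_le_add]
    exact (norm_sub_norm_le _ _).trans (norm_average_sub_average_le hω hd.cont
      (fun s hs u hu => hd.norm_sub_le_omegaNorm hab hω hpos hbdd (hsub hs) (hsub hu)) hγ i1 i2)
  · obtain ⟨k, d, G, hd, hk⟩ := exists_hasDensity_of_mem_W1HBarClass hP hω hab.le hf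
    have hbdd : BddAbove (omegaRatios ω a b (hukuharaDeriv a b f)) :=
      ⟨k, hd.mem_upperBounds_omegaRatios hab hpos hk⟩
    rw [(hd.envelopeRep_hukuharaDeriv hab ht).dist_zero,
      (hd.envelopeRep_dividedDiff hh.le hm₁ hm₂).dist_zero, ← sub_le_iff_le_add]
    exact (norm_sub_norm_le _ _).trans (norm_sub_average_le hω hd.cont hh₁ hh₂ hh
      fun u hu => hd.norm_sub_le_omegaNorm hab hω hpos hbdd ht (hsub hu))
  · obtain ⟨i1, i2⟩ := hbounds γ₁ γ₂ hγ hγsub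
    rcases (show (0 : ℝ) ≤ (h₁ - γ₁) + (h₂ - γ₂) by linarith).eq_or_lt with hL | hL
    -- Both divided differences coincide and the constant is `0`, so any `f` of norm `1` serves; the
    -- extremal for (2) is reused.
    · obtain rfl : γ₁ = h₁ := by linarith
      obtain rfl : γ₂ = h₂ := by linarith
      obtain ⟨f, hf, hn, -⟩ := hderiv hx
      exact ⟨f, hf, hn, by simp [landauK]⟩
    obtain ⟨ψ, hψ, ⟨s, hs, u, hu, hext⟩, heq⟩ := exists_extremal_scalar (t := t) hω hc hγ i1 i2 hL
    obtain ⟨f, hf, C, hn, -, hdd⟩ := exists_mem_W1HClass_of_scalar hP hω hpos hab hx hψ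
      ⟨s, hsub hs, u, hsub hu, hext⟩
    refine ⟨f, hf, hn, ?_⟩
    rw [hn, hdd t h₁ h₂ hh hm₁ hm₂, hdd t γ₁ γ₂ hγ ⟨by linarith, by linarith⟩
      ⟨by linarith, by linarith⟩]
    -- The constant `C` occurs in both divided differences and cancels, leaving `heq`.
    linarith
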